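/- Let $n\ge 1$ and $r>n$ be integers, $\tau\in\mathbb C$ with $\operatorname{Im}\tau>0$, $\gamma=1/r$. Let $$\theta(z,\tau)=-\sum_{m\in\mathbb Z}e^{i\pi(m+\frac12)^2\tau+2\pi i(m+\frac12)(z+\frac12)},\qquad [z]=\frac{\theta(\gamma z,\tau)}{\gamma\,\theta'(0,\tau)},\qquad \Lambda=\mathbb Z r+\mathbb Z r\tau .$$ Let $P=\mathbb Z^n$ with standard basis $\epsilon_1,\dots,\epsilon_n$, let $O_0=\mathbb Z^n/\mathbb Z(1,\dots,1)$, on which $P$ acts by translations, and let $P^r_{++}=\{a\in O_0 : a_1>\dots>a_n,\ a_1-a_n<r\}$. For $a\in O_0$ with $[a_i-a_j]\ne 0$ $(i\neq j)$ put $$\check R(z,a)=\sum_i E_{ii}\otimes E_{ii}-\sum_{i\ne j}\frac{[a_i-a_j+1][z]}{[a_i-a_j][1-z]}E_{ij}\otimes E_{ji}+\sum_{i\neq j}\frac{[a_i-a_j+z][1]}{[a_i-a_j][1-z]}E_{ii}\otimes E_{jj}\in\operatorname{End}(\mathbb C^n\otimes\mathbb C^n).$$ For a groupoid $\pi$, a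 $\pi$-graded vector space of finite type over $\mathbb C$ is a family $(V_\alpha)$ of finite-dimensional complex vector spaces indexed by the arrows of $\pi$ such that for every object $a$ only finitely many arrows with source or target $a$ carry a nonzero space. Morphisms are families of linear maps, $(V\otimes W)_\gamma=\bigoplus_{\beta\circ\alpha=\gamma}V_\alpha\otimes W_\beta$, and $\mathrm{Vect}_{\mathbb C}(\pi)$ is the resulting category, with the evident associativity isomorphisms. A Yang--Baxter operator on $V$ is a meromorphic family $\check R(z)\in\operatorname{End}(V\otimes V)$ with $$\check R(z-w)^{(23)}\check R(z)^{(12)}\check R(w)^{(23)}=\check R(w)^{(12)}\check R(z)^{(23)}\check R(z-w)^{(12)},\qquad \check R(z)\check R(-z)=\mathrm{id},$$ whenever all factors are regular. Let $O_0\rtimes P$ be the action groupoid, whose arrows are the pairs $(a,\mu)$ with source $a$ and target $a+\mu$, and let $\pi$ be its full subgroupoid on $P^r_{++}$. Let $V$ be the $O_0\rtimes P$-graded vector space with $V_{(a,\epsilon_i)}=\mathbb C e_i$ and all other components zero. Let $\check R(z)$ act on the part of $V\otimes V$ with source $a$ by $\check R(z,a)$. Let $V^{\mathrm{RSOS}}\subset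 V$ be the subspace with $V^{\mathrm{RSOS}}_\gamma=V_\gamma$ for $\gamma\in\pi$ and $0$ otherwise. Then: 1. $\pi$ has finitely many objects, and $[a_i-a_j]\neq0$ for all $a\in P^r_{++}$ and $i\ne j$. 2. For $a\in P^r_{++}$ and $z,w\in\mathbb C$ with $1-z,\ 1-w,\ 1-(z-w)\notin\Lambda$, the dynamical Yang--Baxter equation $$\check R(z-w,a+h^{(1)})^{(23)}\check R(z,a)^{(12)}\check R(w,a+h^{(1)})^{(23)}=\check R(w,a)^{(12)}\check R(z,a+h^{(1)})^{(23)}\check R(z-w,a)^{(12)}$$ holds on the span of the $e_i\otimes e_j\otimes e_k$ for which $a+\epsilon_i$, $a+\epsilon_i+\epsilon_j$, $a+\epsilon_i+\epsilon_j+\epsilon_k$ all lie in $P^r_{++}$. Here $\check R(z,a+h^{(1)})^{(23)}(e_i\otimes v)=e_i\otimes\check R(z,a+\epsilon_i)v$. 3. $\check R(z)$ maps $V^{\mathrm{RSOS}}\otimes V^{\mathrm{RSOS}}$ to itself, and its restriction, as a function of $z$, is regular at every $z$ with $1-z\notin\Lambda$ and is a Yang--Baxter operator on $V^{\mathrm{RSOS}}$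 in $\mathrm{Vect}_{\mathbb C}(\pi)$. -/

import Mathlib

open CategoryTheory
open scoped TensorProduct DirectSum Kronecker

universe u

noncomputable section

/-! ## Vector spaces graded by a groupoid -/

/-- A `π`-graded vector space of finite type over `k`: a finite-dimensional vector space for each
arrow of `π` such that, for each object `a`, only finitely many arrows with source `a` and only
finitely many arrows with target `a` carry a nonzero space. -/
structure GradedVect (k : Type u) [Field k] (π : Type u) [Groupoid.{u} π] where
  carrier : ∀ {a b : π}, (a ⟶ b) → Type u
  [addCommGroup : ∀ {a b : π} (f : a ⟶ b), AddCommGroup (carrier f)]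
  [module : ∀ {a b : π} (f : a ⟶ b), Module k (carrier f)]
  [finiteDimensional : ∀ {a b : π} (f : a ⟶ b), FiniteDimensional k (carrier f)]
  finite_source : ∀ a : π, {p : Σ b : π, (a ⟶ b) | Nontrivial (carrier p.2)}.Finite
  finite_target : ∀ b : π, {p : Σ a : π, (a ⟶ b) | Nontrivial (carrier p.2)}.Finite

attribute [instance] GradedVect.addCommGroup GradedVect.module GradedVect.finiteDimensional

/-- A pair of composable arrows `fst`, `snd` (first `fst`, then `snd`) with composite `γ`. -/
structure Factorization {π : Type u} [Groupoid.{u} π] {a b : π} (γ : a ⟶ b) where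
  mid : π
  fst : a ⟶ mid
  snd : mid ⟶ b
  comp_eq : fst ≫ snd = γ

namespace GradedVect

variable {k : Type u} [Field k] {π : Type u} [Groupoid.{u} π]

/-- A morphism of graded vector spaces is a family of linear maps indexed by the arrows. -/
@[ext]
structure Hom (V W : GradedVect k π) where
  app : ∀ {a b : π} (γ : a ⟶ b), V.carrier γ →ₗ[k] W.carrier γ

/-- The category `Vect_k(π)`. -/
instance : Category (GradedVect k π) where
  Hom V W := Hom V W
  id V := ⟨fun _ => LinearMap.id⟩
  comp f g := ⟨fun γ => g.app γ ∘ₗ f.app γ⟩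

/-- The component of degree `γ` of the tensor product: the direct sum of `V_α ⊗ W_β` over all
pairs `(α, β)` whose composite (`α` first) is `γ`. -/
abbrev TensorCarrier (V W : GradedVect k π) {a b : π} (γ : a ⟶ b) : Type u :=
  ⨁ p : Factorization γ, V.carrier p.fst ⊗[k] W.carrier p.snd

open Classical in
/-- The inclusion of the summand `V_α ⊗ W_β` in `(V ⊗ W)_γ`. -/
abbrev tensorLof (V W : GradedVect k π) {a b : π} {γ : a ⟶ b} (p : Factorization γ) :
    V.carrier p.fst ⊗[k] W.carrier p.snd →ₗ[k] TensorCarrier V W γ :=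
  DirectSum.lof k (Factorization γ) (fun p => V.carrier p.fst ⊗[k] W.carrier p.snd) p

open Classical in
/-- The linear map out of `(V ⊗ W)_γ` with given restrictions to the summands. -/
abbrev tensorDesc (V W : GradedVect k π) {a b : π} {γ : a ⟶ b} {M : Type u} [AddCommGroup M]
    [Module k M] (φ : ∀ p : Factorization γ, V.carrier p.fst ⊗[k] W.carrier p.snd →ₗ[k] M) :
    TensorCarrier V W γ →ₗ[k] M :=
  DirectSum.toModule k (Factorization γ) M φ

theorem nontrivial_left_right {M N : Type u} [AddCommGroup M] [Module k M] [AddCommGroup N]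
    [Module k N] (h : Nontrivial (M ⊗[k] N)) : Nontrivial M ∧ Nontrivial N := by
  constructor
  · by_contra hM
    rw [not_nontrivial_iff_subsingleton] at hM
    exact not_subsingleton (M ⊗[k] N) inferInstance
  · by_contra hN
    rw [not_nontrivial_iff_subsingleton] at hN
    exact not_subsingleton (M ⊗[k] N) inferInstance

theorem finite_factorizations (V W : GradedVect k π) {a b : π} (γ : a ⟶ b) :
    {p : Factorization γ | Nontrivial (V.carrier p.fst ⊗[k] W.carrier p.snd)}.Finite := by
  refine Set.Finite.of_finite_image (f := fun p : Factorization γ =>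
    (⟨p.mid, p.fst⟩ : Σ c : π, (a ⟶ c))) ((V.finite_source a).subset ?_) ?_
  · rintro _ ⟨p, hp, rfl⟩
    exact (nontrivial_left_right hp).1
  · rintro ⟨m, f, g, h⟩ _ ⟨m', f', g', h'⟩ _ e
    simp only [Sigma.mk.injEq] at e
    obtain ⟨rfl, e⟩ := e
    obtain rfl := eq_of_heq e
    have : g = g' := by
      rw [← cancel_epi f, h, h']
    subst this
    rfl

theorem exists_of_nontrivial (V W : GradedVect k π) {a b : π} (γ : a ⟶ b)
    (h : Nontrivial (TensorCarrier V W γ)) :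
    ∃ p : Factorization γ, Nontrivial (V.carrier p.fst) ∧ Nontrivial (W.carrier p.snd) := by
  by_contra hn
  push Not at hn
  obtain ⟨x, hx⟩ := exists_ne (0 : TensorCarrier V W γ)
  apply hx
  refine DFinsupp.ext fun p => ?_
  have : Subsingleton (V.carrier p.fst ⊗[k] W.carrier p.snd) := by
    by_contra hs
    rw [not_subsingleton_iff_nontrivial] at hs
    obtain ⟨h1, h2⟩ := nontrivial_left_right hs
    exact not_nontrivial_iff_subsingleton.mpr (hn p h1) h2
  exact Subsingleton.elim _ _

instance finiteDimensional_tensorCarrier (V W : GradedVect k π) {a b : π} (γ : a ⟶ b) :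
    FiniteDimensional k (TensorCarrier V W γ) := by
  have : Finite {p : Factorization γ | Nontrivial (V.carrier p.fst ⊗[k] W.carrier p.snd)} :=
    (finite_factorizations V W γ).to_subtype
  let S := {p : Factorization γ | Nontrivial (V.carrier p.fst ⊗[k] W.carrier p.snd)}
  let F : TensorCarrier V W γ →ₗ[k] (∀ p : S, V.carrier p.1.fst ⊗[k] W.carrier p.1.snd) :=
    LinearMap.pi fun p => DirectSum.component k _ _ p.1
  refine Module.Finite.of_injective F fun x y hxy => DFinsupp.ext fun p => ?_
  by_cases hp : p ∈ S
  · exact congrFun hxy ⟨p, hp⟩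
  · have : Subsingleton (V.carrier p.fst ⊗[k] W.carrier p.snd) :=
      not_nontrivial_iff_subsingleton.mp hp
    exact Subsingleton.elim _ _

/-- The tensor product of graded vector spaces. -/
def tensor (V W : GradedVect k π) : GradedVect k π where
  carrier γ := TensorCarrier V W γ
  finite_source a := by
    refine Set.Finite.subset ((V.finite_source a).biUnion (t := fun p =>
      (fun q : Σ b : π, (p.1 ⟶ b) => (⟨q.1, p.2 ≫ q.2⟩ : Σ b : π, (a ⟶ b))) ''
        {q | Nontrivial (W.carrier q.2)}) fun p _ => (W.finite_source p.1).image _) ?_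
    rintro ⟨b, γ⟩ h
    obtain ⟨⟨m, f, g, rfl⟩, hV, hW⟩ := exists_of_nontrivial V W γ h
    exact Set.mem_biUnion (x := (⟨m, f⟩ : Σ b : π, (a ⟶ b))) hV ⟨⟨b, g⟩, hW, rfl⟩
  finite_target b := by
    refine Set.Finite.subset ((W.finite_target b).biUnion (t := fun q =>
      (fun p : Σ a : π, (a ⟶ q.1) => (⟨p.1, p.2 ≫ q.2⟩ : Σ a : π, (a ⟶ b))) ''
        {p | Nontrivial (V.carrier p.2)}) fun q _ => (V.finite_target q.1).image _) ?_
    rintro ⟨a, γ⟩ h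
    obtain ⟨⟨m, f, g, rfl⟩, hV, hW⟩ := exists_of_nontrivial V W γ h
    exact Set.mem_biUnion (x := (⟨m, g⟩ : Σ a : π, (a ⟶ b))) hW ⟨⟨a, f⟩, hV, rfl⟩

/-- The tensor product of morphisms. -/
def tensorMap {V V' W W' : GradedVect k π} (f : V ⟶ V') (g : W ⟶ W') :
    tensor V W ⟶ tensor V' W' where
  app γ := DirectSum.lmap fun p : Factorization γ =>
    TensorProduct.map (Hom.app f p.fst) (Hom.app g p.snd)

/-- The associativity constraint `(U ⊗ V) ⊗ W → U ⊗ (V ⊗ W)`, given on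
`(U_α ⊗ V_β) ⊗ W_γ` by the associativity constraint of vector spaces. -/
def assocHom (U V W : GradedVect k π) : tensor (tensor U V) W ⟶ tensor U (tensor V W) where
  app _ := tensorDesc (tensor U V) W fun p =>
    TensorProduct.lift (tensorDesc U V fun q =>
      TensorProduct.curry
        (tensorLof U (tensor V W) ⟨q.mid, q.fst, q.snd ≫ p.snd, by
            rw [← Category.assoc, q.comp_eq, p.comp_eq]⟩ ∘ₗ
          LinearMap.lTensor (U.carrier q.fst) (tensorLof V W ⟨p.mid, q.snd, p.snd, rfl⟩) ∘ₗ
          (TensorProduct.assoc k (U.carrier q.fst) (V.carrier q.snd)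
            (W.carrier p.snd)).toLinearMap))

/-- The inverse associativity constraint `U ⊗ (V ⊗ W) → (U ⊗ V) ⊗ W`. -/
def assocInv (U V W : GradedVect k π) : tensor U (tensor V W) ⟶ tensor (tensor U V) W where
  app _ := tensorDesc U (tensor V W) fun p =>
    TensorProduct.lift (LinearMap.flip (tensorDesc V W fun q =>
      LinearMap.flip (TensorProduct.curry
        (tensorLof (tensor U V) W ⟨q.mid, p.fst ≫ q.fst, q.snd, by
            rw [Category.assoc, q.comp_eq, p.comp_eq]⟩ ∘ₗ
          LinearMap.rTensor (W.carrier q.snd) (tensorLof U V ⟨p.mid, p.fst, q.fst, rfl⟩) ∘ₗ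
          (TensorProduct.assoc k (U.carrier p.fst) (V.carrier q.fst)
            (W.carrier q.snd)).symm.toLinearMap))))

theorem assocHom_apply (U V W : GradedVect k π) {a b : π} {γ : a ⟶ b} (p : Factorization γ)
    (q : Factorization p.fst) (x : U.carrier q.fst) (y : V.carrier q.snd) (z : W.carrier p.snd) :
    Hom.app (assocHom U V W) γ
      (tensorLof (tensor U V) W p (tensorLof U V q (x ⊗ₜ y) ⊗ₜ z)) =
    tensorLof U (tensor V W) ⟨q.mid, q.fst, q.snd ≫ p.snd, by
            rw [← Category.assoc, q.comp_eq, p.comp_eq]⟩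
      (x ⊗ₜ tensorLof V W ⟨p.mid, q.snd, p.snd, rfl⟩ (y ⊗ₜ z)) := by
  classical
  simp only [assocHom, tensorDesc]
  erw [DirectSum.toModule_lof, TensorProduct.lift.tmul]
  erw [DirectSum.toModule_lof]
  rfl

theorem assocInv_apply (U V W : GradedVect k π) {a b : π} {γ : a ⟶ b} (p : Factorization γ)
    (q : Factorization p.snd) (x : U.carrier p.fst) (y : V.carrier q.fst) (z : W.carrier q.snd) :
    Hom.app (assocInv U V W) γ
      (tensorLof U (tensor V W) p (x ⊗ₜ tensorLof V W q (y ⊗ₜ z))) =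
    tensorLof (tensor U V) W ⟨q.mid, p.fst ≫ q.fst, q.snd, by
            rw [Category.assoc, q.comp_eq, p.comp_eq]⟩
      (tensorLof U V ⟨p.mid, p.fst, q.fst, rfl⟩ (x ⊗ₜ y) ⊗ₜ z) := by
  classical
  simp only [assocInv, tensorDesc]
  erw [DirectSum.toModule_lof, TensorProduct.lift.tmul, LinearMap.flip_apply]
  erw [DirectSum.toModule_lof]
  rfl

theorem assoc_hom_inv (U V W : GradedVect k π) : assocHom U V W ≫ assocInv U V W = 𝟙 _ := by
  classical
  refine Hom.ext ?_
  funext a b γ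
  show (assocInv U V W).app γ ∘ₗ (assocHom U V W).app γ = LinearMap.id
  refine DirectSum.linearMap_ext _ fun p => TensorProduct.ext (DirectSum.linearMap_ext _ fun q =>
    TensorProduct.ext (LinearMap.ext fun x => LinearMap.ext fun y => LinearMap.ext fun z => ?_))
  refine (congrArg ((assocInv U V W).app γ) (assocHom_apply U V W p q x y z)).trans ?_
  refine (assocInv_apply U V W
    ⟨q.mid, q.fst, q.snd ≫ p.snd, by rw [← Category.assoc, q.comp_eq, p.comp_eq]⟩
    (⟨p.mid, q.snd, p.snd, rfl⟩ : Factorization (q.snd ≫ p.snd)) x y z).trans ?_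
  obtain ⟨m, f, g, h⟩ := p
  dsimp only at q
  obtain ⟨m', f', g', rfl⟩ := q
  rfl

theorem assoc_inv_hom (U V W : GradedVect k π) : assocInv U V W ≫ assocHom U V W = 𝟙 _ := by
  classical
  refine Hom.ext ?_
  funext a b γ
  show (assocHom U V W).app γ ∘ₗ (assocInv U V W).app γ = LinearMap.id
  refine DirectSum.linearMap_ext _ fun p => TensorProduct.ext (LinearMap.ext fun x =>
    DirectSum.linearMap_ext _ fun q =>
    TensorProduct.ext (LinearMap.ext fun y => LinearMap.ext fun z => ?_))
  refine (congrArg ((assocHom U V W).app γ) (assocInv_apply U V W p q x y z)).trans ?_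
  refine (assocHom_apply U V W
    ⟨q.mid, p.fst ≫ q.fst, q.snd, by rw [Category.assoc, q.comp_eq, p.comp_eq]⟩
    (⟨p.mid, p.fst, q.fst, rfl⟩ : Factorization (p.fst ≫ q.fst)) x y z).trans ?_
  obtain ⟨m, f, g, h⟩ := p
  dsimp only at q
  obtain ⟨m', f', g', rfl⟩ := q
  rfl

/-- The associativity constraint as an isomorphism. -/
def associator (U V W : GradedVect k π) : tensor (tensor U V) W ≅ tensor U (tensor V W) where
  hom := assocHom U V W
  inv := assocInv U V W
  hom_inv_id := assoc_hom_inv U V W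
  inv_hom_id := assoc_inv_hom U V W

/-- The action `f^(12)` of `f` on the first two factors of `(V ⊗ V) ⊗ V`. -/
def act12 {V : GradedVect k π} (f : tensor V V ⟶ tensor V V) :
    tensor (tensor V V) V ⟶ tensor (tensor V V) V :=
  tensorMap f (𝟙 V)

/-- The action `f^(23)` of `f` on the last two factors of `(V ⊗ V) ⊗ V`. -/
def act23 {V : GradedVect k π} (f : tensor V V ⟶ tensor V V) :
    tensor (tensor V V) V ⟶ tensor (tensor V V) V :=
  (associator V V V).hom ≫ tensorMap (𝟙 V) f ≫ (associator V V V).inv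

/-! ### Full subgroupoids -/

/-- The full subgroupoid of `π` on a set `B` of objects. -/
abbrev FullSub (B : Set π) : Type u := InducedCategory π (Subtype.val : B → π)

/-- The `FullSub B`-graded vector space with the same components as `V`. Extended by zero to `π`,
it is the graded subspace of `V` supported on the arrows of `FullSub B`. -/
def restrict (V : GradedVect k π) (B : Set π) : GradedVect k (FullSub B) where
  carrier f := V.carrier f.hom
  finite_source a := by
    refine Set.Finite.of_finite_image (f := fun p : Σ b : FullSub B, (a ⟶ b) =>
      (⟨p.1.1, p.2.hom⟩ : Σ b : π, (a.1 ⟶ b))) ((V.finite_source a.1).subset ?_) ?_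
    · rintro _ ⟨p, hp, rfl⟩
      exact hp
    · rintro ⟨⟨b, hb⟩, ⟨f⟩⟩ _ ⟨⟨b', hb'⟩, ⟨f'⟩⟩ _ e
      simp only [Sigma.mk.injEq] at e
      obtain ⟨rfl, e⟩ := e
      obtain rfl := eq_of_heq e
      rfl
  finite_target b := by
    refine Set.Finite.of_finite_image (f := fun p : Σ a : FullSub B, (a ⟶ b) =>
      (⟨p.1.1, p.2.hom⟩ : Σ a : π, (a ⟶ b.1))) ((V.finite_target b.1).subset ?_) ?_
    · rintro _ ⟨p, hp, rfl⟩
      exact hp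
    · rintro ⟨⟨a, ha⟩, ⟨f⟩⟩ _ ⟨⟨a', ha'⟩, ⟨f'⟩⟩ _ e
      simp only [Sigma.mk.injEq] at e
      obtain ⟨rfl, e⟩ := e
      obtain rfl := eq_of_heq e
      rfl

/-- The inclusion of `V|_B ⊗ W|_B` in `V ⊗ W`, in the degree of an arrow of `FullSub B`. -/
def restrictTensorIncl (V W : GradedVect k π) (B : Set π) {a b : FullSub B} (γ : a ⟶ b) :
    (tensor (V.restrict B) (W.restrict B)).carrier γ →ₗ[k] (tensor V W).carrier γ.hom :=
  tensorDesc (V.restrict B) (W.restrict B) fun p =>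
    tensorLof V W (γ := γ.hom) ⟨p.mid.1, p.fst.hom, p.snd.hom, by
      rw [← InducedCategory.comp_hom, p.comp_eq]⟩

/-- The endomorphism `S` of `V|_B ⊗ V|_B` is the restriction of the endomorphism `R` of `V ⊗ V`:
`R` maps the subspace `V|_B ⊗ V|_B` to itself and acts there as `S`. -/
def IsRestriction {V : GradedVect k π} {B : Set π} (R : tensor V V ⟶ tensor V V)
    (S : tensor (V.restrict B) (V.restrict B) ⟶ tensor (V.restrict B) (V.restrict B)) : Prop :=
  ∀ {a b : FullSub B} (γ : a ⟶ b) (x : (tensor (V.restrict B) (V.restrict B)).carrier γ),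
    Hom.app R γ.hom (restrictTensorIncl V V B γ x) = restrictTensorIncl V V B γ (Hom.app S γ x)

end GradedVect

/-! ## Yang–Baxter operators -/

namespace GradedVect

variable {π : Type} [Groupoid.{0} π]

/-- A family of morphisms of complex graded vector spaces is meromorphic if all matrix entries of
all its (finite-dimensional) components are. -/
def MeromorphicFamily {V W : GradedVect ℂ π} (f : ℂ → (V ⟶ W)) : Prop :=
  ∀ {a b : π} (γ : a ⟶ b) (x : V.carrier γ) (l : W.carrier γ →ₗ[ℂ] ℂ),
    Meromorphic fun z => l (Hom.app (f z) γ x)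

/-- The family `f` is holomorphic near `z`. -/
def RegularAt {V W : GradedVect ℂ π} (f : ℂ → (V ⟶ W)) (z : ℂ) : Prop :=
  ∀ {a b : π} (γ : a ⟶ b) (x : V.carrier γ) (l : W.carrier γ →ₗ[ℂ] ℂ),
    AnalyticAt ℂ (fun z => l (Hom.app (f z) γ x)) z

/-- A Yang–Baxter operator on `V`: a meromorphic family of endomorphisms of `V ⊗ V` obeying the
Yang–Baxter equation
`R(z-w)^(23) R(z)^(12) R(w)^(23) = R(w)^(12) R(z)^(23) R(z-w)^(12)` and the inversion relation
`R(z) R(-z) = id`, whenever all factors are regular. Composition `≫` is written in the order in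
which the maps are applied. -/
structure IsYangBaxterOperator (V : GradedVect ℂ π) (R : ℂ → (tensor V V ⟶ tensor V V)) :
    Prop where
  meromorphic : MeromorphicFamily R
  yang_baxter : ∀ z w : ℂ, RegularAt R z → RegularAt R w → RegularAt R (z - w) →
    act23 (R w) ≫ act12 (R z) ≫ act23 (R (z - w)) =
      act12 (R (z - w)) ≫ act23 (R z) ≫ act12 (R w)
  inversion : ∀ z : ℂ, RegularAt R z → RegularAt R (-z) → R (-z) ≫ R z = 𝟙 (tensor V V)

end GradedVect

/-! ## The action groupoid of the weight lattice -/

/-- The weight `ε_i` of the weight lattice `P = ℤⁿ`. -/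
def eps {n : ℕ} (i : Fin n) : Fin n → ℤ := Pi.single i 1

/-- The orbit `O_0 = ℤⁿ / ℤ(1,…,1)` of the origin under the weight lattice `P = ℤⁿ`. -/
def Orbit (n : ℕ) : Type := (Fin n → ℤ) ⧸ AddSubgroup.zmultiples (1 : Fin n → ℤ)

instance (n : ℕ) : AddCommGroup (Orbit n) :=
  inferInstanceAs (AddCommGroup ((Fin n → ℤ) ⧸ AddSubgroup.zmultiples (1 : Fin n → ℤ)))

namespace Orbit

variable {n : ℕ}

/-- The projection `ℤⁿ → ℤⁿ / ℤ(1,…,1)`. -/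
def proj (n : ℕ) : (Fin n → ℤ) →+ Orbit n :=
  QuotientAddGroup.mk' (AddSubgroup.zmultiples (1 : Fin n → ℤ))

/-- The function `a ↦ a_i - a_j` on `ℤⁿ / ℤ(1,…,1)`. -/
def diff (i j : Fin n) : Orbit n →+ ℤ :=
  QuotientAddGroup.lift (AddSubgroup.zmultiples (1 : Fin n → ℤ))
    (Pi.evalAddMonoidHom (fun _ : Fin n => ℤ) i - Pi.evalAddMonoidHom (fun _ : Fin n => ℤ) j) (by
      intro x hx
      obtain ⟨m, rfl⟩ := AddSubgroup.mem_zmultiples_iff.mp hx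
      simp)

theorem diff_proj (i j : Fin n) (lam : Fin n → ℤ) : diff i j (proj n lam) = lam i - lam j := rfl

/-- The action groupoid `O_0 ⋊ P`: an arrow from `a` to `b` is a weight `μ ∈ P` with
`a + μ = b`. -/
instance : Groupoid.{0} (Orbit n) where
  Hom a b := {μ : Fin n → ℤ // a + proj n μ = b}
  id a := ⟨0, by simp⟩
  comp f g := ⟨f.1 + g.1, by rw [map_add, ← add_assoc, f.2, g.2]⟩
  id_comp f := Subtype.ext (zero_add f.1)
  comp_id f := Subtype.ext (add_zero f.1)
  assoc f g h := Subtype.ext (add_assoc f.1 g.1 h.1)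
  inv f := ⟨-f.1, by rw [map_neg, ← sub_eq_add_neg, sub_eq_iff_eq_add]; exact f.2.symm⟩
  inv_comp f := Subtype.ext (neg_add_cancel f.1)
  comp_inv f := Subtype.ext (add_neg_cancel f.1)

/-- The weight of an arrow of `O_0 ⋊ P`. -/
def weight {a b : Orbit n} (f : a ⟶ b) : Fin n → ℤ := Subtype.val f

/-- The arrow `(a, μ)`. -/
def arrow (a : Orbit n) (μ : Fin n → ℤ) {b : Orbit n} (h : a + proj n μ = b) : a ⟶ b := ⟨μ, h⟩

end Orbit

/-- The set `P_{++}^r` of regular dominant affine weights of level `r`: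
`a_1 > ⋯ > a_n` and `a_1 - a_n < r`. -/
def regularDominant (n r : ℕ) : Set (Orbit n) :=
  {a | ∀ i j : Fin n, i < j → 0 < Orbit.diff i j a ∧ Orbit.diff i j a < r}

/-- The groupoid of the restricted model: the full subgroupoid of `O_0 ⋊ P` on `P_{++}^r`. -/
abbrev RSOSGroupoid (n r : ℕ) : Type := GradedVect.FullSub (regularDominant n r)

/-- The vector representation on `O_0 ⋊ P`: its component in degree `(a, μ)` is `ℂ e_i` if
`μ = ε_i`, and zero if `μ` is none of the `ε_i`. -/
def vectorRep (n : ℕ) : GradedVect ℂ (Orbit n) where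
  carrier f := {i : Fin n // eps i = Orbit.weight f} → ℂ
  finite_source a := by
    refine (Set.finite_range fun i : Fin n => (⟨a + Orbit.proj n (eps i),
      Orbit.arrow a (eps i) rfl⟩ : Σ b : Orbit n, (a ⟶ b))).subset ?_
    rintro ⟨b, ⟨μ, hμ⟩⟩ h
    have : Nonempty {i : Fin n // eps i = μ} := by
      by_contra hn
      rw [not_nonempty_iff] at hn
      exact not_subsingleton_iff_nontrivial.mpr h
        (inferInstanceAs (Subsingleton ({i : Fin n // eps i = μ} → ℂ)))
    obtain ⟨i, rfl⟩ := this
    subst hμ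
    exact ⟨i, rfl⟩
  finite_target b := by
    refine (Set.finite_range fun i : Fin n => (⟨b - Orbit.proj n (eps i),
      Orbit.arrow _ (eps i) (sub_add_cancel _ _)⟩ : Σ a : Orbit n, (a ⟶ b))).subset ?_
    rintro ⟨a, ⟨μ, hμ⟩⟩ h
    have : Nonempty {i : Fin n // eps i = μ} := by
      by_contra hn
      rw [not_nonempty_iff] at hn
      exact not_subsingleton_iff_nontrivial.mpr h
        (inferInstanceAs (Subsingleton ({i : Fin n // eps i = μ} → ℂ)))
    obtain ⟨i, rfl⟩ := this
    obtain rfl : a = b - Orbit.proj n (eps i) := eq_sub_of_add_eq hμ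
    exact ⟨i, rfl⟩

/-- The restricted vector representation: the components `ℂ e_i` in degrees `(a, ε_i)` with `a`
and `a + ε_i` in `P_{++}^r`. -/
def rsosRep (n r : ℕ) : GradedVect ℂ (RSOSGroupoid n r) :=
  (vectorRep n).restrict (regularDominant n r)

/-! ## The elliptic dynamical `R`-matrix -/

/-- The odd Jacobi theta function. -/
def oddTheta (z τ : ℂ) : ℂ :=
  -∑' m : ℤ, Complex.exp (Complex.I * Real.pi * ((m : ℂ) + 1 / 2) ^ 2 * τ +
    2 * Real.pi * Complex.I * ((m : ℂ) + 1 / 2) * (z + 1 / 2))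

/-- The function `[z] = θ(γ z, τ) / (γ θ'(0, τ))` for `γ = 1 / r`. -/
def ellBracket (τ : ℂ) (r : ℕ) (z : ℂ) : ℂ :=
  oddTheta (1 / (r : ℂ) * z) τ / (1 / (r : ℂ) * deriv (fun x => oddTheta x τ) 0)

/-- The lattice `Λ = ℤ r + ℤ r τ`. -/
def ellLattice (τ : ℂ) (r : ℕ) : Set ℂ :=
  {z | ∃ p q : ℤ, z = p * (r : ℂ) + q * ((r : ℂ) * τ)}

/-- The matrix unit `E_{ij}`. -/
def matUnit {n : ℕ} (i j : Fin n) : Matrix (Fin n) (Fin n) ℂ := Matrix.single i j 1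

/-- The elliptic dynamical `R`-matrix `Ř(z, a)` on `ℂⁿ ⊗ ℂⁿ` in the basis `e_i ⊗ e_j`, for
dynamical variable `a` in the orbit of the origin. -/
def ellR {n : ℕ} (τ : ℂ) (r : ℕ) (z : ℂ) (a : Orbit n) :
    Matrix (Fin n × Fin n) (Fin n × Fin n) ℂ :=
  ∑ i : Fin n, matUnit i i ⊗ₖ matUnit i i
  - ∑ p ∈ (Finset.univ : Finset (Fin n)).offDiag,
      ((ellBracket τ r ((Orbit.diff p.1 p.2 a : ℂ) + 1) * ellBracket τ r z) /
        (ellBracket τ r (Orbit.diff p.1 p.2 a : ℂ) * ellBracket τ r (1 - z))) •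
          (matUnit p.1 p.2 ⊗ₖ matUnit p.2 p.1)
  + ∑ p ∈ (Finset.univ : Finset (Fin n)).offDiag,
      ((ellBracket τ r ((Orbit.diff p.1 p.2 a : ℂ) + z) * ellBracket τ r 1) /
        (ellBracket τ r (Orbit.diff p.1 p.2 a : ℂ) * ellBracket τ r (1 - z))) •
          (matUnit p.1 p.1 ⊗ₖ matUnit p.2 p.2)

open GradedVect in
/-- The vector `e_i ⊗ e_j ∈ V_{(a, ε_i)} ⊗ V_{(a + ε_i, ε_j)}`, viewed in degree
`(a, ε_i + ε_j)`. -/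
def pathVector {n : ℕ} {a b : Orbit n} (γ : a ⟶ b) (i j : Fin n)
    (h : eps i + eps j = Orbit.weight γ) :
    (tensor (vectorRep n) (vectorRep n)).carrier γ :=
  tensorLof (vectorRep n) (vectorRep n) (γ := γ)
    ⟨a + Orbit.proj n (eps i), Orbit.arrow a (eps i) rfl,
      Orbit.arrow (a + Orbit.proj n (eps i)) (eps j) (by
        have h2 : a + Orbit.proj n (Orbit.weight γ) = b := Subtype.property γ
        rw [add_assoc, ← map_add, h, h2]),
      Subtype.ext h⟩
    ((Pi.single (⟨i, rfl⟩ : {i' : Fin n // eps i' = eps i}) (1 : ℂ) :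
        {i' : Fin n // eps i' = eps i} → ℂ) ⊗ₜ[ℂ]
      (Pi.single (⟨j, rfl⟩ : {j' : Fin n // eps j' = eps j}) (1 : ℂ) :
        {j' : Fin n // eps j' = eps j} → ℂ))

open GradedVect in
/-- The endomorphism `Ř(z)` of `V ⊗ V` for the vector representation `V` on `O_0 ⋊ P`: on the
components with source `a` it acts by `Ř(z, a)`. (It has its intended meaning only on the components
whose source `a` is not on a pole `[a_i - a_j] = 0`.) -/
def ellROp (n r : ℕ) (τ z : ℂ) :
    tensor (vectorRep n) (vectorRep n) ⟶ tensor (vectorRep n) (vectorRep n) where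
  app {a _} γ := tensorDesc (vectorRep n) (vectorRep n) fun p =>
    (((Pi.basisFun ℂ {i : Fin n // eps i = Orbit.weight p.fst}).tensorProduct
        (Pi.basisFun ℂ {j : Fin n // eps j = Orbit.weight p.snd})).constr ℂ) fun ij =>
      ∑ kl : {kl : Fin n × Fin n // eps kl.1 + eps kl.2 = Orbit.weight γ},
        ellR τ r z a kl.1 (ij.1.1, ij.2.1) • pathVector γ kl.1.1 kl.1.2 kl.2

/-! ## The dynamical Yang–Baxter equation in coordinates -/

/-- The operator `Ř(z, a)^(12)` on `ℂⁿ ⊗ ℂⁿ ⊗ ℂⁿ`. -/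
def dynR12 {n : ℕ} (τ : ℂ) (r : ℕ) (z : ℂ) (a : Orbit n) :
    Matrix (Fin n × Fin n × Fin n) (Fin n × Fin n × Fin n) ℂ :=
  fun x y => if x.2.2 = y.2.2 then ellR τ r z a (x.1, x.2.1) (y.1, y.2.1) else 0

/-- The operator `Ř(z, a + h^(1))^(23)` on `ℂⁿ ⊗ ℂⁿ ⊗ ℂⁿ`, acting on `e_i ⊗ v` as
`e_i ⊗ Ř(z, a + ε_i) v`. -/
def dynR23 {n : ℕ} (τ : ℂ) (r : ℕ) (z : ℂ) (a : Orbit n) :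
    Matrix (Fin n × Fin n × Fin n) (Fin n × Fin n × Fin n) ℂ :=
  fun x y => if x.1 = y.1 then
    ellR τ r z (a + Orbit.proj n (eps y.1)) (x.2.1, x.2.2) (y.2.1, y.2.2) else 0

/-- The triples `(i, j, k)` for which `a + ε_i`, `a + ε_i + ε_j`, `a + ε_i + ε_j + ε_k` all lie in
`P_{++}^r`; for `a` in `P_{++}^r` the corresponding `e_i ⊗ e_j ⊗ e_k` form a basis of the part of
the third tensor power of the restricted vector representation with source `a`. -/
def rsosPaths {n : ℕ} (r : ℕ) (a : Orbit n) : Set (Fin n × Fin n × Fin n) :=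
  {x | a + Orbit.proj n (eps x.1) ∈ regularDominant n r ∧
    a + Orbit.proj n (eps x.1 + eps x.2.1) ∈ regularDominant n r ∧
    a + Orbit.proj n (eps x.1 + eps x.2.1 + eps x.2.2) ∈ regularDominant n r}

end

/-!
# The restricted elliptic model of type `A_{n-1}`

The bracket `[z]` is an odd entire function satisfying Weierstrass's three-term identity
(`IsWeierstrassOdd`), and its zeros are exactly the points of `Λ`. Everything else is algebra and
combinatorics on top of these two facts.

*The theta function.* Splitting the double series of `θ(x + y) θ(x - y)` by the parity of the
difference of the indices gives `A(x) B(y) - B(x) A(y)` with two theta functions of modulus `2 τ`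
(`oddTheta_add_mul_sub`). The three-term identity is the Plücker relation of these determinants. The
zero at the origin is simple: otherwise the Wronskian of `A` and `B` would vanish, and then `A` and
`B` would be proportional. If `a` is any zero, the three-term identity makes the product of the
values of `θ(u + a) / θ(u)` at two points depend only on their sum, so that this quotient is an
exponential, and comparison with the quasi-periods `1` and `τ` forces `a ∈ ℤ + ℤ τ`
(`exists_int_of_oddTheta_eq_zero`). Hence `[d]` vanishes for an integer `d` only if `r ∣ d`, and no
difference `a_i - a_j` of a point of the alcove is divisible by `r`.

*The Yang–Baxter equation.* The operator maps `e_i ⊗ e_j` with `i ≠ j` to a combination of `e_i ⊗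
e_j` and `e_j ⊗ e_i`, with weights `stayWeight` and `swapWeight` depending on `a_i - a_j`. On the
weight spaces `2 ε_i + ε_j` and `ε_i + ε_j + ε_k` the matrix entries of the dynamical Yang–Baxter
equation are consequences of four special cases of the three-term identity (`exchange_identity`,
`transfer_identity`, `cube_identity`, `square_identity`). All dynamical denominators occurring in
them are values `[d]` at differences `d` of coordinates of the two ends of the path, so the equation
holds as soon as both ends lie in the alcove (`dybe_tripleVec`).

*The restricted space.* If a transition leads from a path in the alcove to a path leaving it, then
its weight has a factor `[0]` or `[r]`, which is zero (`swapWeight_eq_zero_of_notMem`). So `Ř(z)`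
restricts, and in the basis of paths the operators `Ř^(12)`, `Ř^(23)` of the graded category are the
matrices `dynR12`, `dynR23` (`act12_tripleMap`, `act23_tripleMap`).

*Regularity.* The Yang–Baxter equation is required wherever the restricted family is regular. For
`n ≥ 2` it has a pole at each `z` with `1 - z ∈ Λ` (`ellBracket_ne_zero_of_regularAt`); for `n = 1`
it does not depend on `z`.
-/

noncomputable section

open GradedVect

/-! ### The odd theta function -/

theorem oddTheta_term_eq (m : ℤ) (z τ : ℂ) :
    Complex.exp (Complex.I * Real.pi * ((m : ℂ) + 1 / 2) ^ 2 * τ +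
      2 * Real.pi * Complex.I * ((m : ℂ) + 1 / 2) * (z + 1 / 2)) =
    Complex.exp (Real.pi * Complex.I * (τ / 4 + z + 1 / 2)) *
      jacobiTheta₂_term m (z + 1 / 2 + τ / 2) τ := by
  rw [jacobiTheta₂_term, ← Complex.exp_add]
  congr 1
  ring

theorem oddTheta_eq_jacobiTheta₂ (z τ : ℂ) :
    oddTheta z τ = -(Complex.exp (Real.pi * Complex.I * (τ / 4 + z + 1 / 2)) *
      jacobiTheta₂ (z + 1 / 2 + τ / 2) τ) := by
  simp only [oddTheta, oddTheta_term_eq, jacobiTheta₂, tsum_mul_left]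

theorem neg_exp_eq (z : ℂ) : -Complex.exp z = Complex.exp (z + Real.pi * Complex.I) :=
  (Complex.exp_antiperiodic z).symm

theorem oddTheta_add_one (z τ : ℂ) : oddTheta (z + 1) τ = -oddTheta z τ := by
  rw [oddTheta_eq_jacobiTheta₂, oddTheta_eq_jacobiTheta₂,
    show z + 1 + 1 / 2 + τ / 2 = z + 1 / 2 + τ / 2 + 1 by ring, jacobiTheta₂_add_left,
    show Real.pi * Complex.I * (τ / 4 + (z + 1) + 1 / 2) =
      Real.pi * Complex.I * (τ / 4 + z + 1 / 2) + Real.pi * Complex.I by ring,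
    Complex.exp_add, Complex.exp_pi_mul_I]
  ring

theorem oddTheta_add_tau (z τ : ℂ) :
    oddTheta (z + τ) τ = -(Complex.exp (-(Real.pi * Complex.I * (τ + 2 * z))) * oddTheta z τ) := by
  rw [oddTheta_eq_jacobiTheta₂, oddTheta_eq_jacobiTheta₂,
    show z + τ + 1 / 2 + τ / 2 = z + 1 / 2 + τ / 2 + τ by ring, jacobiTheta₂_add_left']
  have h : Complex.exp (Real.pi * Complex.I * (τ / 4 + (z + τ) + 1 / 2)) *
      Complex.exp (-(Real.pi * Complex.I * (τ + 2 * (z + 1 / 2 + τ / 2)))) =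
      -(Complex.exp (-(Real.pi * Complex.I * (τ + 2 * z))) *
        Complex.exp (Real.pi * Complex.I * (τ / 4 + z + 1 / 2))) := by
    rw [← Complex.exp_add, ← Complex.exp_add, neg_exp_eq,
      Complex.exp_eq_exp_iff_exists_int]
    refine ⟨-1, ?_⟩
    push_cast
    ring
  rw [show ∀ a b c : ℂ, a * (b * c) = a * b * c by intros; ring]
  rw [show -(Real.pi * Complex.I * (τ + 2 * (z + 1 / 2 + τ / 2))) =
    -Real.pi * Complex.I * (τ + 2 * (z + 1 / 2 + τ / 2)) by ring] at h
  rw [h]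
  ring

theorem oddTheta_neg (z τ : ℂ) : oddTheta (-z) τ = -oddTheta z τ := by
  rw [oddTheta_eq_jacobiTheta₂, oddTheta_eq_jacobiTheta₂,
    show z + 1 / 2 + τ / 2 = (z - 1 / 2 - τ / 2) + τ + 1 by ring, jacobiTheta₂_add_left,
    jacobiTheta₂_add_left', show -z + 1 / 2 + τ / 2 = -(z - 1 / 2 - τ / 2) by ring,
    jacobiTheta₂_neg_left]
  have h : Complex.exp (Real.pi * Complex.I * (τ / 4 + z + 1 / 2)) *
      Complex.exp (-Real.pi * Complex.I * (τ + 2 * (z - 1 / 2 - τ / 2))) =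
      -Complex.exp (Real.pi * Complex.I * (τ / 4 + -z + 1 / 2)) := by
    rw [← Complex.exp_add, neg_exp_eq, Complex.exp_eq_exp_iff_exists_int]
    refine ⟨0, ?_⟩
    push_cast
    ring
  rw [show ∀ a b c : ℂ, a * (b * c) = a * b * c by intros; ring, h]
  ring

theorem oddTheta_zero (τ : ℂ) : oddTheta 0 τ = 0 := by
  have h := oddTheta_neg 0 τ
  rw [neg_zero] at h
  exact self_eq_neg.mp h

theorem differentiable_jacobiTheta₂_fst {τ : ℂ} (hτ : 0 < τ.im) :
    Differentiable ℂ fun z => jacobiTheta₂ z τ :=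
  fun z => differentiableAt_jacobiTheta₂_fst z hτ

theorem differentiable_oddTheta {τ : ℂ} (hτ : 0 < τ.im) :
    Differentiable ℂ fun z => oddTheta z τ := by
  simp only [oddTheta_eq_jacobiTheta₂]
  have h := differentiable_jacobiTheta₂_fst hτ
  fun_prop

/-- The even half of the splitting of `θ(x + y) θ(x - y)` into theta functions of modulus `2 τ`. -/
def evenHalf (τ z : ℂ) : ℂ := jacobiTheta₂ (2 * z) (2 * τ)

/-- The odd half of the splitting of `θ(x + y) θ(x - y)` into theta functions of modulus `2 τ`:
the theta series of modulus `2 τ` over the half-integers, at `2 z`. -/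
def oddHalf (τ z : ℂ) : ℂ :=
  Complex.exp (Real.pi * Complex.I * (τ / 2 + 2 * z)) * jacobiTheta₂ (2 * z + τ) (2 * τ)

theorem differentiable_evenHalf {τ : ℂ} (hτ : 0 < τ.im) : Differentiable ℂ (evenHalf τ) := by
  have h := differentiable_jacobiTheta₂_fst (τ := 2 * τ) (by simpa using hτ)
  unfold evenHalf
  fun_prop

theorem differentiable_oddHalf {τ : ℂ} (hτ : 0 < τ.im) : Differentiable ℂ (oddHalf τ) := by
  have h := differentiable_jacobiTheta₂_fst (τ := 2 * τ) (by simpa using hτ)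
  unfold oddHalf
  fun_prop

theorem summable_norm_jacobiTheta₂_term (z : ℂ) {τ : ℂ} (hτ : 0 < τ.im) :
    Summable fun n : ℤ => ‖jacobiTheta₂_term n z τ‖ :=
  ((summable_jacobiTheta₂_term_iff z τ).mpr hτ).norm

theorem hasSum_jacobiTheta₂_mul (x y : ℂ) {τ : ℂ} (hτ : 0 < τ.im) :
    HasSum (fun p : ℤ × ℤ => jacobiTheta₂_term p.1 x τ * jacobiTheta₂_term p.2 y τ)
      (jacobiTheta₂ x τ * jacobiTheta₂ y τ) :=
  HasSum.mul (f := fun m : ℤ => jacobiTheta₂_term m x τ)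
    (g := fun n : ℤ => jacobiTheta₂_term n y τ)
    (hasSum_jacobiTheta₂_term x hτ) (hasSum_jacobiTheta₂_term y hτ)
    (summable_mul_of_summable_norm (f := fun m : ℤ => jacobiTheta₂_term m x τ)
      (g := fun n : ℤ => jacobiTheta₂_term n y τ) (summable_norm_jacobiTheta₂_term x hτ)
      (summable_norm_jacobiTheta₂_term y hτ))

/-- The product `θ(x + y) θ(x - y)` is a `2 × 2` determinant: in the double series over `(m, n)`
the terms with `m - n` odd, respectively even, separate after the substitution
`(m, n) ↦ (m + n, m - n)`. -/
theorem oddTheta_add_mul_sub {τ : ℂ} (hτ : 0 < τ.im) (x y : ℂ) :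
    oddTheta (x + y) τ * oddTheta (x - y) τ =
      evenHalf τ x * oddHalf τ y - oddHalf τ x * evenHalf τ y := by
  have h2 : 0 < (2 * τ).im := by simpa using hτ
  let c : ℂ := Complex.exp (Real.pi * Complex.I * (τ / 4 + (x + y) + 1 / 2)) *
    Complex.exp (Real.pi * Complex.I * (τ / 4 + (x - y) + 1 / 2))
  let F : ℤ × ℤ → ℂ := fun p => c * (jacobiTheta₂_term p.1 (x + y + 1 / 2 + τ / 2) τ *
      jacobiTheta₂_term p.2 (x - y + 1 / 2 + τ / 2) τ)
  have hF : HasSum F (oddTheta (x + y) τ * oddTheta (x - y) τ) := by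
    have h := (hasSum_jacobiTheta₂_mul (x + y + 1 / 2 + τ / 2) (x - y + 1 / 2 + τ / 2)
      hτ).mul_left c
    have e : oddTheta (x + y) τ * oddTheta (x - y) τ =
        c * (jacobiTheta₂ (x + y + 1 / 2 + τ / 2) τ * jacobiTheta₂ (x - y + 1 / 2 + τ / 2) τ) := by
      rw [oddTheta_eq_jacobiTheta₂, oddTheta_eq_jacobiTheta₂]
      simp only [c]
      ring
    rw [e]
    exact h
  let φ : ℤ × ℤ → ℤ × ℤ := fun p => (p.1 + p.2, p.1 - p.2 - 1)
  let ψ : ℤ × ℤ → ℤ × ℤ := fun p => (p.1 + p.2, p.1 - p.2)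
  have hφ : Function.Injective φ := by
    rintro ⟨a, b⟩ ⟨a', b'⟩ h
    simp only [φ, Prod.mk.injEq] at h ⊢
    omega
  have hψ : Function.Injective ψ := by
    rintro ⟨a, b⟩ ⟨a', b'⟩ h
    simp only [ψ, Prod.mk.injEq] at h ⊢
    omega
  have hc : IsCompl (Set.range φ) (Set.range ψ) := by
    constructor
    · rw [Set.disjoint_left]
      rintro _ ⟨⟨a, b⟩, rfl⟩ ⟨⟨a', b'⟩, h⟩
      simp only [φ, ψ, Prod.mk.injEq] at h
      omega
    · rw [codisjoint_iff, Set.top_eq_univ, Set.eq_univ_iff_forall]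
      rintro ⟨m, n⟩
      rcases Int.even_or_odd (m + n) with ⟨t, ht⟩ | ⟨t, ht⟩
      · exact Or.inr ⟨(t, m - t), by simp only [ψ, Prod.mk.injEq]; omega⟩
      · exact Or.inl ⟨(t + 1, m - t - 1), by simp only [φ, Prod.mk.injEq]; omega⟩
  have hA : HasSum (F ∘ φ) (evenHalf τ x * oddHalf τ y) := by
    have h := (hasSum_jacobiTheta₂_mul (2 * x) (2 * y + τ) h2).mul_left
      (Complex.exp (Real.pi * Complex.I * (τ / 2 + 2 * y)))
    have e : ∀ p, F (φ p) = Complex.exp (Real.pi * Complex.I * (τ / 2 + 2 * y)) *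
        (jacobiTheta₂_term p.1 (2 * x) (2 * τ) * jacobiTheta₂_term p.2 (2 * y + τ) (2 * τ)) := by
      intro p
      simp only [F, φ, c, jacobiTheta₂_term, ← Complex.exp_add]
      rw [Complex.exp_eq_exp_iff_exists_int]
      refine ⟨p.1, ?_⟩
      push_cast
      ring
    rw [show evenHalf τ x * oddHalf τ y = _ from mul_left_comm _ _ _]
    exact (funext e : F ∘ _ = _) ▸ h
  have hB : HasSum (F ∘ ψ) (-(oddHalf τ x * evenHalf τ y)) := by
    have h := ((hasSum_jacobiTheta₂_mul (2 * x + τ) (2 * y) h2).mul_left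
      (Complex.exp (Real.pi * Complex.I * (τ / 2 + 2 * x)))).neg
    have e : ∀ p, F (ψ p) = -(Complex.exp (Real.pi * Complex.I * (τ / 2 + 2 * x)) *
        (jacobiTheta₂_term p.1 (2 * x + τ) (2 * τ) * jacobiTheta₂_term p.2 (2 * y) (2 * τ))) := by
      intro p
      simp only [F, ψ, c, jacobiTheta₂_term, ← Complex.exp_add]
      rw [neg_exp_eq, Complex.exp_eq_exp_iff_exists_int]
      refine ⟨p.1, ?_⟩
      push_cast
      ring
    rw [show oddHalf τ x * evenHalf τ y = _ from mul_assoc _ _ _]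
    exact (funext e : F ∘ _ = _) ▸ h
  have := HasSum.add_isCompl hc (hφ.hasSum_range_iff.mpr hA) (hψ.hasSum_range_iff.mpr hB)
  rw [hF.unique this, sub_eq_add_neg]

/-- Weierstrass's three-term identity, as the Plücker relation of the determinants in
`oddTheta_add_mul_sub`. -/
theorem oddTheta_three_term {τ : ℂ} (hτ : 0 < τ.im) (x y z w : ℂ) :
    oddTheta (x + y) τ * oddTheta (x - y) τ * (oddTheta (z + w) τ * oddTheta (z - w) τ) -
      oddTheta (x + z) τ * oddTheta (x - z) τ * (oddTheta (y + w) τ * oddTheta (y - w) τ) +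
      oddTheta (x + w) τ * oddTheta (x - w) τ * (oddTheta (y + z) τ * oddTheta (y - z) τ) = 0 := by
  simp only [oddTheta_add_mul_sub hτ]
  ring

theorem integral_jacobiTheta₂_term (n : ℤ) (τ : ℂ) :
    ∫ x in (0 : ℝ)..1, jacobiTheta₂_term n x τ = if n = 0 then 1 else 0 := by
  split_ifs with h
  · simp [h, jacobiTheta₂_term]
  · have hc : (2 * Real.pi * Complex.I * n : ℂ) ≠ 0 := by
      simp [h, Real.pi_ne_zero]
    simp only [jacobiTheta₂_term, Complex.exp_add]
    rw [intervalIntegral.integral_mul_const, integral_exp_mul_complex hc]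
    have : Complex.exp (2 * Real.pi * Complex.I * n * (1 : ℝ)) = 1 :=
      Complex.exp_eq_one_iff.mpr ⟨n, by push_cast; ring⟩
    rw [this]
    simp

/-- The constant Fourier coefficient of `z ↦ jacobiTheta₂ z τ` is `1`, so this function does not
vanish identically. -/
theorem exists_jacobiTheta₂_ne_zero {τ : ℂ} (hτ : 0 < τ.im) : ∃ z, jacobiTheta₂ z τ ≠ 0 := by
  by_contra! h
  have hs : HasSum (fun n : ℤ => ∫ x in (0 : ℝ)..1, jacobiTheta₂_term n x τ)
      (∫ x in (0 : ℝ)..1, ∑' n : ℤ, jacobiTheta₂_term n x τ) := by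
    have hb : ∀ (n : ℤ) (x : ℝ), ‖jacobiTheta₂_term n x τ‖ = ‖jacobiTheta₂_term n 0 τ‖ := by
      intro n x
      simp [norm_jacobiTheta₂_term]
    refine intervalIntegral.hasSum_integral_of_dominated_convergence
      (fun n _ => ‖jacobiTheta₂_term n 0 τ‖) (fun n => ?_) (fun n => ?_) ?_ ?_ ?_
    · refine Continuous.aestronglyMeasurable ?_
      unfold jacobiTheta₂_term
      fun_prop
    · exact .of_forall fun x _ => (hb n x).le
    · exact .of_forall fun x _ => summable_norm_jacobiTheta₂_term 0 hτ
    · exact intervalIntegrable_const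
    · exact .of_forall fun x _ => hasSum_jacobiTheta₂_term x hτ
  have h0 : ∀ x : ℝ, ∑' n : ℤ, jacobiTheta₂_term n x τ = 0 := fun x => h x
  simp only [integral_jacobiTheta₂_term, h0, intervalIntegral.integral_zero] at hs
  exact one_ne_zero ((hasSum_ite_eq (0 : ℤ) (1 : ℂ)).unique hs)

theorem exists_oddTheta_ne_zero {τ : ℂ} (hτ : 0 < τ.im) : ∃ z, oddTheta z τ ≠ 0 := by
  obtain ⟨z, hz⟩ := exists_jacobiTheta₂_ne_zero hτ
  refine ⟨z - 1 / 2 - τ / 2, ?_⟩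
  rw [oddTheta_eq_jacobiTheta₂, show z - 1 / 2 - τ / 2 + 1 / 2 + τ / 2 = z by ring]
  exact neg_ne_zero.mpr (mul_ne_zero (Complex.exp_ne_zero _) hz)

/-! ### Zeros of the odd theta function -/

/-- Two entire functions with vanishing Wronskian are proportional. -/
theorem eq_const_mul_of_wronskian_eq_zero {f g : ℂ → ℂ} (hf : Differentiable ℂ f)
    (hg : Differentiable ℂ g) (h : ∀ x, deriv g x * f x = g x * deriv f x) {x₀ : ℂ}
    (h₀ : f x₀ ≠ 0) (x : ℂ) : g x = g x₀ / f x₀ * f x := by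
  obtain ⟨ε, hε, hne⟩ := Metric.eventually_nhds_iff_ball.mp
    (hf.continuous.continuousAt.eventually_ne h₀)
  have hq : ∀ y ∈ Metric.ball x₀ ε, HasDerivAt (fun y => g y / f y) 0 y := by
    intro y hy
    have := (hg y).hasDerivAt.div (hf y).hasDerivAt (hne y hy)
    rwa [h y, sub_self, zero_div] at this
  have hc : ∀ y ∈ Metric.ball x₀ ε, g y = g x₀ / f x₀ * f y := by
    intro y hy
    have := (convex_ball x₀ ε).is_const_of_fderivWithin_eq_zero (𝕜 := ℂ)
      (f := fun y => g y / f y)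
      (fun y hy => (hq y hy).differentiableAt.differentiableWithinAt)
      (fun y hy => by
        rw [fderivWithin_of_isOpen Metric.isOpen_ball hy, (hq y hy).hasFDerivAt.fderiv]
        simp) hy (Metric.mem_ball_self hε)
    rw [← this, div_mul_cancel₀ _ (hne y hy)]
  have ha : AnalyticOnNhd ℂ g Set.univ := fun y _ => hg.analyticAt y
  have hb : AnalyticOnNhd ℂ (fun y => g x₀ / f x₀ * f y) Set.univ :=
    fun y _ => (hf.const_mul _).analyticAt y
  exact congrFun (ha.eq_of_eventuallyEq hb
    (Filter.eventuallyEq_of_mem (Metric.ball_mem_nhds x₀ hε) hc)) x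

/-- A multiple zero at the origin would make the Wronskian of `evenHalf` and `oddHalf` vanish,
hence also their determinant `θ(x + y) θ(x - y)`. -/
theorem deriv_oddTheta_zero_ne_zero {τ : ℂ} (hτ : 0 < τ.im) :
    deriv (fun z => oddTheta z τ) 0 ≠ 0 := by
  intro h0
  have hA := differentiable_evenHalf hτ
  have hB := differentiable_oddHalf hτ
  have hf := differentiable_oddTheta hτ
  obtain ⟨u, hu⟩ := exists_oddTheta_ne_zero hτ
  have hF : evenHalf τ u * oddHalf τ 0 - oddHalf τ u * evenHalf τ 0 ≠ 0 := by
    rw [← oddTheta_add_mul_sub hτ, add_zero, sub_zero]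
    exact mul_ne_zero hu hu
  have hW : ∀ x, deriv (evenHalf τ) x * oddHalf τ x = evenHalf τ x * deriv (oddHalf τ) x := by
    intro x
    have h1 : HasDerivAt (fun y => oddTheta (x + y) τ * oddTheta (x - y) τ) 0 x := by
      have e1 : HasDerivAt (fun y => oddTheta (x + y) τ) _ x :=
        ((hf (x + x)).hasDerivAt).comp_const_add x x
      have e2 : HasDerivAt (fun y => oddTheta (x - y) τ) _ x :=
        ((hf (x - x)).hasDerivAt).comp_const_sub x x
      exact (e1.mul e2).congr_deriv (by simp [h0, oddTheta_zero])
    have h2 : HasDerivAt (fun y => evenHalf τ x * oddHalf τ y - oddHalf τ x * evenHalf τ y) _ x :=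
      ((hB x).hasDerivAt.const_mul _).sub ((hA x).hasDerivAt.const_mul _)
    simp only [oddTheta_add_mul_sub hτ] at h1
    have := h1.unique h2
    linear_combination this
  by_cases hz : ∀ x, oddHalf τ x = 0
  · simp [hz] at hF
  · push Not at hz
    obtain ⟨x₀, hx₀⟩ := hz
    have := eq_const_mul_of_wronskian_eq_zero hB hA hW hx₀
    rw [this u, this 0] at hF
    exact hF (by ring)

/-- If `a` is a zero, the three-term identity shows that `θ(u + a) / θ(u)` is an exponential
`c e^{A u}`; comparing with the translations by `1` and `τ` gives `a ∈ ℤ + ℤ τ`. -/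
theorem exists_int_of_oddTheta_eq_zero {τ : ℂ} (hτ : 0 < τ.im) {a : ℂ}
    (ha : oddTheta a τ = 0) : ∃ p q : ℤ, a = p + q * τ := by
  have hf := differentiable_oddTheta hτ
  set f : ℂ → ℂ := fun z => oddTheta z τ with hfdef
  have hfa : Differentiable ℂ fun u => f (u + a) := hf.comp (differentiable_id.add_const a)
  -- the three-term identity with `x - w = a`: the product of the values of `θ(u + a) / θ(u)` at two
  -- points depends only on their sum
  have rel : ∀ p q s t : ℂ, p + q = s + t →
      f (p + a) * f (q + a) * (f s * f t) = f (s + a) * f (t + a) * (f p * f q) := by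
    intro p q s t h
    have h3 := oddTheta_three_term hτ ((p + q) / 2 + a) ((p - q) / 2) ((s - t) / 2) ((p + q) / 2)
    have hs : s = p + q - t := by linear_combination -h
    subst hs
    rw [show (p + q) / 2 + a + (p - q) / 2 = p + a by ring,
      show (p + q) / 2 + a - (p - q) / 2 = q + a by ring,
      show (p + q - t - t) / 2 + (p + q) / 2 = p + q - t by ring,
      show (p + q - t - t) / 2 - (p + q) / 2 = -t by ring,
      show (p + q) / 2 + a + (p + q - t - t) / 2 = p + q - t + a by ring,
      show (p + q) / 2 + a - (p + q - t - t) / 2 = t + a by ring,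
      show (p - q) / 2 + (p + q) / 2 = p by ring,
      show (p - q) / 2 - (p + q) / 2 = -q by ring,
      show (p + q) / 2 + a - (p + q) / 2 = a by ring,
      oddTheta_neg t, oddTheta_neg q, ha] at h3
    simp only [hfdef]
    linear_combination -h3
  obtain ⟨u₀, hu₀, hu₁⟩ : ∃ u₀, f u₀ ≠ 0 ∧ f (u₀ + a) ≠ 0 := by
    by_contra! hn
    obtain ⟨x, hx⟩ := exists_oddTheta_ne_zero hτ
    have hloc : (fun u => f (u + a)) =ᶠ[nhds x] 0 := by
      filter_upwards [hf.continuous.continuousAt.eventually_ne hx] with u hu using hn u hu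
    have han : AnalyticOnNhd ℂ (fun u => f (u + a)) Set.univ := fun y _ => hfa.analyticAt y
    have := congrFun (han.eq_of_eventuallyEq (fun y _ => analyticAt_const) hloc) (x - a)
    simp only [sub_add_cancel] at this
    exact hx this
  -- differentiating this relation: the logarithmic derivative of `θ(u + a) / θ(u)` is constant
  have hD : ∀ v, f u₀ * f (u₀ + a) * (deriv f (v + a) * f v - f (v + a) * deriv f v) =
      f v * f (v + a) * (deriv f (u₀ + a) * f u₀ - f (u₀ + a) * deriv f u₀) := by
    intro v
    have d : ∀ c, HasDerivAt (fun y => f (c + y)) (deriv f c) 0 := by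
      intro c
      have := (hf (c + 0)).hasDerivAt.comp_const_add c 0
      rwa [add_zero] at this
    have h1 := ((d (u₀ + a)).const_mul (f (v + a))).mul ((d v).mul_const (f u₀))
    have h2 := ((d (v + a)).mul_const (f (u₀ + a))).mul ((d u₀).const_mul (f v))
    have e : (fun y => f (v + a) * f (u₀ + a + y) * (f (v + y) * f u₀)) =
        fun y => f (v + a + y) * f (u₀ + a) * (f v * f (u₀ + y)) := by
      funext y
      have := rel v (u₀ + y) (v + y) u₀ (by ring)
      rw [show u₀ + y + a = u₀ + a + y by ring, show v + y + a = v + a + y by ring] at this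
      exact this
    change HasDerivAt (fun y => f (v + a) * f (u₀ + a + y) * (f (v + y) * f u₀)) _ 0 at h1
    change HasDerivAt (fun y => f (v + a + y) * f (u₀ + a) * (f v * f (u₀ + y))) _ 0 at h2
    rw [e] at h1
    have := h1.unique h2
    simp only [add_zero] at this
    linear_combination -this
  set A : ℂ := (deriv f (u₀ + a) * f u₀ - f (u₀ + a) * deriv f u₀) / (f u₀ * f (u₀ + a)) with hA
  have hD' : ∀ v, deriv f (v + a) * f v - f (v + a) * deriv f v = A * (f v * f (v + a)) := by
    intro v
    rw [hA]
    field_simp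
    linear_combination hD v
  have hg : ∀ v, HasDerivAt (fun v => f (v + a) * Complex.exp (-(A * v)))
      ((deriv f (v + a) - A * f (v + a)) * Complex.exp (-(A * v))) v := by
    intro v
    have e1 : HasDerivAt (fun v => f (v + a)) (deriv f (v + a)) v :=
      (hf (v + a)).hasDerivAt.comp_add_const v a
    have e2 : HasDerivAt (fun v => Complex.exp (-(A * v))) (Complex.exp (-(A * v)) * -(A * 1)) v :=
      (((hasDerivAt_id v).const_mul A).neg).cexp
    exact (e1.mul e2).congr_deriv (by ring)
  have hprop := eq_const_mul_of_wronskian_eq_zero hf (fun v => (hg v).differentiableAt)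
    (fun v => by
      rw [(hg v).deriv]
      linear_combination Complex.exp (-(A * v)) * hD' v) hu₀
  set c : ℂ := f (u₀ + a) * Complex.exp (-(A * u₀)) / f u₀ with hc
  have hc0 : c ≠ 0 := div_ne_zero (mul_ne_zero hu₁ (Complex.exp_ne_zero _)) hu₀
  have hprop' : ∀ v, f (v + a) = c * Complex.exp (A * v) * f v := by
    intro v
    have h := hprop v
    have e : Complex.exp (-(A * v)) * Complex.exp (A * v) = 1 := by
      rw [← Complex.exp_add, neg_add_cancel, Complex.exp_zero]
    linear_combination Complex.exp (A * v) * h - f (v + a) * e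
  clear_value c
  have hE := hprop' u₀
  have hone : Complex.exp A = 1 := by
    have h := hprop' (u₀ + 1)
    rw [show u₀ + 1 + a = u₀ + a + 1 by ring, mul_add, mul_one, Complex.exp_add] at h
    simp only [hfdef, oddTheta_add_one] at h hE hu₀
    rw [hE] at h
    have hk : c * Complex.exp (A * u₀) * oddTheta u₀ τ ≠ 0 :=
      mul_ne_zero (mul_ne_zero hc0 (Complex.exp_ne_zero _)) hu₀
    apply mul_left_cancel₀ hk
    linear_combination h
  have htau : Complex.exp (-(2 * Real.pi * Complex.I * a)) = Complex.exp (A * τ) := by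
    have h := hprop' (u₀ + τ)
    rw [show u₀ + τ + a = u₀ + a + τ by ring, mul_add, Complex.exp_add] at h
    simp only [hfdef, oddTheta_add_tau] at h hE hu₀
    rw [hE, show -(Real.pi * Complex.I * (τ + 2 * (u₀ + a))) =
      -(Real.pi * Complex.I * (τ + 2 * u₀)) + -(2 * Real.pi * Complex.I * a) by ring,
      Complex.exp_add] at h
    have hk : Complex.exp (-(Real.pi * Complex.I * (τ + 2 * u₀))) *
        (c * Complex.exp (A * u₀) * oddTheta u₀ τ) ≠ 0 :=
      mul_ne_zero (Complex.exp_ne_zero _)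
        (mul_ne_zero (mul_ne_zero hc0 (Complex.exp_ne_zero _)) hu₀)
    apply mul_left_cancel₀ hk
    linear_combination -h
  obtain ⟨n, hn⟩ := Complex.exp_eq_one_iff.mp hone
  obtain ⟨m, hm⟩ := Complex.exp_eq_exp_iff_exists_int.mp htau
  refine ⟨-m, -n, ?_⟩
  have hpi : (2 * Real.pi * Complex.I : ℂ) ≠ 0 := Complex.two_pi_I_ne_zero
  apply mul_left_cancel₀ hpi
  push_cast
  rw [hn] at hm
  linear_combination -hm

theorem oddTheta_int_add_int_mul (p q : ℤ) (τ : ℂ) : oddTheta (p + q * τ) τ = 0 := by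
  have h1 : ∀ (z : ℂ) (p : ℤ), oddTheta z τ = 0 → oddTheta (z + p) τ = 0 := by
    intro z p hz
    induction p using Int.induction_on with
    | zero => simpa using hz
    | succ k ih =>
      have := oddTheta_add_one (z + k) τ
      push_cast at ih ⊢
      rw [← add_assoc, this, ih, neg_zero]
    | pred k ih =>
      have := oddTheta_add_one (z + (-k - 1)) τ
      push_cast at ih ⊢
      rw [show z + (-(k : ℂ) - 1) + 1 = z + -k by ring, ih] at this
      exact neg_eq_zero.mp this.symm
  have h2 : ∀ q : ℤ, oddTheta (q * τ) τ = 0 := by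
    intro q
    induction q using Int.induction_on with
    | zero => simpa using oddTheta_zero τ
    | succ k ih =>
      have := oddTheta_add_tau (k * τ) τ
      push_cast at ih ⊢
      rw [add_mul, one_mul, this, ih, mul_zero, neg_zero]
    | pred k ih =>
      have := oddTheta_add_tau ((-k - 1) * τ) τ
      push_cast at ih ⊢
      rw [show (-(k : ℂ) - 1) * τ + τ = -k * τ by ring, ih] at this
      exact (mul_eq_zero.mp (neg_eq_zero.mp this.symm)).resolve_left (Complex.exp_ne_zero _)
  rw [add_comm]
  exact h1 _ p (h2 q)

/-! ### The elliptic bracket -/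

theorem ellBracket_neg (τ : ℂ) (r : ℕ) (z : ℂ) : ellBracket τ r (-z) = -ellBracket τ r z := by
  rw [ellBracket, ellBracket, mul_neg, oddTheta_neg, neg_div]

theorem ellBracket_three_term {τ : ℂ} (hτ : 0 < τ.im) (r : ℕ) (x y z w : ℂ) :
    ellBracket τ r (x + y) * ellBracket τ r (x - y) *
        (ellBracket τ r (z + w) * ellBracket τ r (z - w)) -
      ellBracket τ r (x + z) * ellBracket τ r (x - z) *
        (ellBracket τ r (y + w) * ellBracket τ r (y - w)) +
      ellBracket τ r (x + w) * ellBracket τ r (x - w) *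
        (ellBracket τ r (y + z) * ellBracket τ r (y - z)) = 0 := by
  have h := oddTheta_three_term hτ (1 / (r : ℂ) * x) (1 / (r : ℂ) * y) (1 / (r : ℂ) * z)
    (1 / (r : ℂ) * w)
  simp only [← mul_add, ← mul_sub] at h
  simp only [ellBracket]
  linear_combination (1 / (1 / (r : ℂ) * deriv (fun x => oddTheta x τ) 0)) ^ 4 * h

theorem differentiable_ellBracket {τ : ℂ} (hτ : 0 < τ.im) (r : ℕ) :
    Differentiable ℂ (ellBracket τ r) := by
  have h := differentiable_oddTheta hτ
  unfold ellBracket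
  fun_prop

theorem ellBracket_eq_zero_iff {τ : ℂ} (hτ : 0 < τ.im) {r : ℕ} (hr : r ≠ 0) (z : ℂ) :
    ellBracket τ r z = 0 ↔ z ∈ ellLattice τ r := by
  have hr' : (r : ℂ) ≠ 0 := Nat.cast_ne_zero.mpr hr
  rw [ellBracket, div_eq_zero_iff, or_iff_left
    (mul_ne_zero (one_div_ne_zero hr') (deriv_oddTheta_zero_ne_zero hτ))]
  constructor
  · intro h
    obtain ⟨p, q, hpq⟩ := exists_int_of_oddTheta_eq_zero hτ h
    refine ⟨p, q, ?_⟩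
    field_simp at hpq
    linear_combination hpq
  · rintro ⟨p, q, rfl⟩
    rw [show 1 / (r : ℂ) * (p * r + q * (r * τ)) = p + q * τ by field_simp]
    exact oddTheta_int_add_int_mul p q τ

/-- An integer is a zero of the bracket only if it is divisible by `r`. -/
theorem ellBracket_intCast_eq_zero_iff {τ : ℂ} (hτ : 0 < τ.im) {r : ℕ} (hr : r ≠ 0) (d : ℤ) :
    ellBracket τ r d = 0 ↔ (r : ℤ) ∣ d := by
  rw [ellBracket_eq_zero_iff hτ hr]
  constructor
  · rintro ⟨p, q, h⟩
    have him := congrArg Complex.im h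
    have hq : q = 0 := by
      simpa [hr, hτ.ne'] using him
    refine ⟨p, ?_⟩
    rw [hq] at h
    have : (d : ℂ) = ((r * p : ℤ) : ℂ) := by
      rw [h]
      push_cast
      ring
    exact_mod_cast this
  · rintro ⟨p, rfl⟩
    exact ⟨p, 0, by push_cast; ring⟩

/-! ### Boltzmann weights and their identities -/

/-- An odd function satisfying Weierstrass's three-term identity. -/
structure IsWeierstrassOdd (f : ℂ → ℂ) : Prop where
  neg : ∀ x, f (-x) = -f x
  three_term : ∀ x y z w, f (x + y) * f (x - y) * (f (z + w) * f (z - w)) -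
    f (x + z) * f (x - z) * (f (y + w) * f (y - w)) +
    f (x + w) * f (x - w) * (f (y + z) * f (y - z)) = 0

theorem isWeierstrassOdd_ellBracket {τ : ℂ} (hτ : 0 < τ.im) (r : ℕ) :
    IsWeierstrassOdd (ellBracket τ r) :=
  ⟨ellBracket_neg τ r, ellBracket_three_term hτ r⟩

/-- The weight with which `e_i ⊗ e_j` is mapped to itself, where `d = a_i - a_j`. -/
def stayWeight (f : ℂ → ℂ) (z d : ℂ) : ℂ := f (d + z) * f 1 / (f d * f (1 - z))

/-- The weight with which `e_i ⊗ e_j` is mapped to `e_j ⊗ e_i`, where `d = a_i - a_j`. -/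
def swapWeight (f : ℂ → ℂ) (z d : ℂ) : ℂ := f (1 - d) * f z / (f d * f (1 - z))

namespace IsWeierstrassOdd

variable {f : ℂ → ℂ}

theorem sub_comm (hf : IsWeierstrassOdd f) (x y : ℂ) : f (x - y) = -f (y - x) := by
  rw [← hf.neg, neg_sub]

/-- The three-term identity with the twelve arguments given up to rewriting. -/
theorem three_term_of (hf : IsWeierstrassOdd f) (x y z w : ℂ)
    {a₁ a₂ a₃ a₄ b₁ b₂ b₃ b₄ c₁ c₂ c₃ c₄ : ℂ}
    (ha₁ : a₁ = x + y) (ha₂ : a₂ = x - y) (ha₃ : a₃ = z + w) (ha₄ : a₄ = z - w)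
    (hb₁ : b₁ = x + z) (hb₂ : b₂ = x - z) (hb₃ : b₃ = y + w) (hb₄ : b₄ = y - w)
    (hc₁ : c₁ = x + w) (hc₂ : c₂ = x - w) (hc₃ : c₃ = y + z) (hc₄ : c₄ = y - z) :
    f a₁ * f a₂ * (f a₃ * f a₄) - f b₁ * f b₂ * (f b₃ * f b₄) +
      f c₁ * f c₂ * (f c₃ * f c₄) = 0 := by
  subst ha₁ ha₂ ha₃ ha₄ hb₁ hb₂ hb₃ hb₄ hc₁ hc₂ hc₃ hc₄
  exact hf.three_term x y z w

/-- Exchange of `x` and `y` in `[x + u] [x + v] [y + u + v] [y]`. With `y = -1` this is the entry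
`yb_iij_iij`. -/
theorem exchange_identity (hf : IsWeierstrassOdd f) (x y u v : ℂ) :
    f (x + u) * f (x + v) * f (y + (u + v)) * f y - f (y + u) * f (y + v) * f (x + (u + v)) * f x +
      f (x - y) * f (x + y + (u + v)) * f u * f v = 0 := by
  have := hf.three_term_of (x + (u + v) / 2) ((u - v) / 2) ((u + v) / 2) (y + (u + v) / 2)
    (a₁ := x + u) (a₂ := x + v) (a₃ := y + (u + v)) (a₄ := -y)
    (b₁ := x + (u + v)) (b₂ := x) (b₃ := y + u) (b₄ := -(y + v))
    (c₁ := x + y + (u + v)) (c₂ := x - y) (c₃ := u) (c₄ := -v)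
    (by ring) (by ring) (by ring) (by ring) (by ring) (by ring) (by ring) (by ring)
    (by ring) (by ring) (by ring) (by ring)
  rw [hf.neg y, hf.neg (y + v), hf.neg v] at this
  linear_combination -this

/-- The identity behind the entries that exchange two neighbouring factors. With `x = -1` it gives
`yb_iij_iji` and `yb_iji_iij`. -/
theorem transfer_identity (hf : IsWeierstrassOdd f) (x y u v : ℂ) :
    f (y + v) * f (x + (u + v)) * f u * f (x + y) + f v * f (x + y + (u + v)) * f (y - u) * f x =
      f (x + u) * f (u + v) * f (x + y + v) * f y := by
  have := hf.three_term_of ((x + y + u) / 2 + v) ((y - x - u) / 2) ((x + y + u) / 2)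
    ((u - x - y) / 2)
    (a₁ := y + v) (a₂ := x + (u + v)) (a₃ := u) (a₄ := x + y)
    (b₁ := x + y + (u + v)) (b₂ := v) (b₃ := -x) (b₄ := y - u)
    (c₁ := u + v) (c₂ := x + y + v) (c₃ := y) (c₄ := -(x + u))
    (by ring) (by ring) (by ring) (by ring) (by ring) (by ring) (by ring) (by ring)
    (by ring) (by ring) (by ring) (by ring)
  rw [hf.neg x, hf.neg (x + u)] at this
  linear_combination this

theorem cube_identity (hf : IsWeierstrassOdd f) (d : ℂ) :
    f (d + 2) * f d ^ 3 - f (d - 1) * f (d + 1) ^ 3 = f (d + (d + 1)) * f 1 ^ 3 := by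
  have := hf.three_term_of (d + 1) 1 d 0
    (a₁ := d + 2) (a₂ := d) (a₃ := d) (a₄ := d)
    (b₁ := d + (d + 1)) (b₂ := 1) (b₃ := 1) (b₄ := 1)
    (c₁ := d + 1) (c₂ := d + 1) (c₃ := d + 1) (c₄ := 1 - d)
    (by ring) (by ring) (by ring) (by ring) (by ring) (by ring) (by ring) (by ring)
    (by ring) (by ring) (by ring) (by ring)
  rw [hf.sub_comm 1 d] at this
  linear_combination this

theorem square_identity (hf : IsWeierstrassOdd f) (x y c : ℂ) :
    f (y + c) * f (y - c) * f x ^ 2 - f (x + c) * f (x - c) * f y ^ 2 =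
      f (x + y) * f (y - x) * f c ^ 2 := by
  have := hf.three_term_of y c x 0
    (a₁ := y + c) (a₂ := y - c) (a₃ := x) (a₄ := x)
    (b₁ := x + y) (b₂ := y - x) (b₃ := c) (b₄ := c)
    (c₁ := y) (c₂ := y) (c₃ := x + c) (c₄ := c - x)
    (by ring) (by ring) (by ring) (by ring) (by ring) (by ring) (by ring) (by ring)
    (by ring) (by ring) (by ring) (by ring)
  rw [hf.sub_comm c x] at this
  linear_combination this

theorem stayWeight_neg (hf : IsWeierstrassOdd f) (z d : ℂ) :
    stayWeight f z (-d) = f (d - z) * f 1 / (f d * f (1 - z)) := by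
  rw [stayWeight, show -d + z = -(d - z) by ring, hf.neg, hf.neg, neg_mul, neg_mul, neg_div_neg_eq]

theorem swapWeight_eq (hf : IsWeierstrassOdd f) (z d : ℂ) :
    swapWeight f z d = -(f (d - 1) * f z / (f d * f (1 - z))) := by
  rw [swapWeight, hf.sub_comm, neg_mul, neg_div]

theorem swapWeight_neg (hf : IsWeierstrassOdd f) (z d : ℂ) :
    swapWeight f z (-d) = -(f (d + 1) * f z / (f d * f (1 - z))) := by
  rw [swapWeight, show 1 - -d = d + 1 by ring, hf.neg, neg_mul, div_neg]

/-! ### Matrix entries of the Yang–Baxter equation in weight `2 ε_i + ε_j`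

The name `yb_s_t` refers to the entry that maps the basis vector `s` to the basis vector `t`. Here
`d = a_i - a_j`, and `u`, `v`, `u + v` are the three spectral parameters. The entries not listed
follow by exchanging `i` and `j`, or involve `swapWeight` only. -/

theorem yb_iij_iij (hf : IsWeierstrassOdd f) {d u v : ℂ} (hd : f d ≠ 0) (hd' : f (d + 1) ≠ 0)
    (hu : f (1 - u) ≠ 0) (hv : f (1 - v) ≠ 0) (huv : f (1 - (u + v)) ≠ 0) :
    stayWeight f v (d + 1) * stayWeight f u (d + 1) +
      swapWeight f v (d + 1) * swapWeight f u (-(d + 1)) * stayWeight f (u + v) d =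
    stayWeight f (u + v) (d + 1) := by
  have h := hf.exchange_identity (d + 1) (-1) u v
  rw [hf.neg 1, show -1 + (u + v) = -(1 - (u + v)) by ring, show -1 + u = -(1 - u) by ring,
    show -1 + v = -(1 - v) by ring, hf.neg, hf.neg, hf.neg,
    show d + 1 - -1 = d + 1 + 1 by ring, show d + 1 + -1 = d by ring] at h
  rw [hf.swapWeight_eq, hf.swapWeight_neg, add_sub_cancel_right]
  simp only [stayWeight]
  field_simp
  linear_combination f 1 * h

theorem yb_iij_iji (hf : IsWeierstrassOdd f) {d u v : ℂ} (hd : f d ≠ 0) (hd' : f (d + 1) ≠ 0)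
    (hu : f (1 - u) ≠ 0) (hv : f (1 - v) ≠ 0) (huv : f (1 - (u + v)) ≠ 0) :
    stayWeight f v (d + 1) * swapWeight f u (d + 1) +
      swapWeight f v (d + 1) * stayWeight f (u + v) d * stayWeight f u (-(d + 1)) =
    swapWeight f (u + v) (d + 1) * stayWeight f v d := by
  have h := hf.transfer_identity (-1) (d + 1) u v
  rw [hf.neg 1, show -1 + (u + v) = -(1 - (u + v)) by ring, show -1 + u = -(1 - u) by ring,
    hf.neg, hf.neg, show -1 + (d + 1) = d by ring] at h
  simp only [hf.swapWeight_eq, hf.stayWeight_neg, add_sub_cancel_right]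
  simp only [stayWeight]
  field_simp
  linear_combination f 1 * h

theorem yb_iji_iij (hf : IsWeierstrassOdd f) {d u v : ℂ} (hd : f d ≠ 0) (hd' : f (d + 1) ≠ 0)
    (hu : f (1 - u) ≠ 0) (hv : f (1 - v) ≠ 0) (huv : f (1 - (u + v)) ≠ 0) :
    stayWeight f v (-(d + 1)) * stayWeight f (u + v) d * swapWeight f u (-(d + 1)) +
      swapWeight f v (-(d + 1)) * stayWeight f u (d + 1) =
    stayWeight f u d * swapWeight f (u + v) (-(d + 1)) := by
  have h := hf.transfer_identity (-1) (d + 1) v u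
  rw [hf.neg 1, show -1 + (v + u) = -(1 - (u + v)) by ring, show -1 + v = -(1 - v) by ring,
    hf.neg, hf.neg, show -1 + (d + 1) = d by ring, add_comm v u] at h
  simp only [hf.swapWeight_neg, hf.stayWeight_neg]
  simp only [stayWeight]
  field_simp
  linear_combination f 1 * f (d + 1 + 1) * h

theorem yb_iji_iji (hf : IsWeierstrassOdd f) {d u v : ℂ} (hd : f d ≠ 0) (hd' : f (d + 1) ≠ 0)
    (hu : f (1 - u) ≠ 0) (hv : f (1 - v) ≠ 0) (huv : f (1 - (u + v)) ≠ 0) :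
    stayWeight f v (-(d + 1)) * stayWeight f (u + v) d * stayWeight f u (-(d + 1)) +
      swapWeight f v (-(d + 1)) * swapWeight f u (d + 1) =
    stayWeight f u d * stayWeight f (u + v) (-(d + 1)) * stayWeight f v d +
      swapWeight f u d * swapWeight f v (-d) := by
  have h := hf.exchange_identity (-(d + 1)) d u v
  rw [hf.neg (d + 1), show -(d + 1) + (u + v) = -(d + 1 - (u + v)) by ring,
    show -(d + 1) + u = -(d + 1 - u) by ring, show -(d + 1) + v = -(d + 1 - v) by ring,
    show -(d + 1) - d = -(d + (d + 1)) by ring,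
    show -(d + 1) + d + (u + v) = -(1 - (u + v)) by ring, hf.neg, hf.neg, hf.neg, hf.neg,
    hf.neg] at h
  have h' := hf.cube_identity d
  rw [show d + 2 = d + 1 + 1 by ring] at h'
  simp only [hf.swapWeight_neg, hf.stayWeight_neg, hf.swapWeight_eq, add_sub_cancel_right]
  simp only [stayWeight]
  field_simp
  linear_combination f 1 ^ 3 * h + f u * f v * f (1 - (u + v)) * h'

/-! ### Matrix entries of the Yang–Baxter equation in weight `ε_i + ε_j + ε_k`

Here `x = a_i - a_j` and `y = a_j - a_k`. -/

theorem yb_ijk_ijk (hf : IsWeierstrassOdd f) {x y u v : ℂ} (hx : f x ≠ 0) (hy : f y ≠ 0)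
    (hxy : f (x + y) ≠ 0)
    (hu : f (1 - u) ≠ 0) (hv : f (1 - v) ≠ 0) (huv : f (1 - (u + v)) ≠ 0) :
    stayWeight f v y * stayWeight f (u + v) x * stayWeight f u y +
      swapWeight f v y * stayWeight f (u + v) (x + y) * swapWeight f u (-y) =
    stayWeight f u x * stayWeight f (u + v) y * stayWeight f v x +
      swapWeight f u x * stayWeight f (u + v) (x + y) * swapWeight f v (-x) := by
  have h := hf.exchange_identity x y u v
  have h' := hf.square_identity x y 1
  rw [hf.sub_comm x y] at h
  simp only [hf.swapWeight_neg, hf.swapWeight_eq, stayWeight]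
  field_simp
  linear_combination (-f 1 ^ 3 * f (x + y)) * h + f 1 * f u * f v * f (x + y + (u + v)) * h'

theorem yb_ijk_ikj (hf : IsWeierstrassOdd f) {x y u v : ℂ} (hx : f x ≠ 0) (hy : f y ≠ 0)
    (hxy : f (x + y) ≠ 0)
    (hu : f (1 - u) ≠ 0) (hv : f (1 - v) ≠ 0) (huv : f (1 - (u + v)) ≠ 0) :
    stayWeight f v y * stayWeight f (u + v) x * swapWeight f u y +
      swapWeight f v y * stayWeight f (u + v) (x + y) * stayWeight f u (-y) =
    stayWeight f u x * swapWeight f (u + v) y * stayWeight f v (x + y) := by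
  have h := hf.transfer_identity x y u v
  simp only [hf.stayWeight_neg, hf.swapWeight_eq]
  simp only [stayWeight]
  field_simp
  linear_combination (-f 1 ^ 2 * f (y - 1)) * h

/-! ### Matrix entries of the inversion relation -/

theorem inversion_ij_ij (hf : IsWeierstrassOdd f) {d z : ℂ} (hd : f d ≠ 0)
    (hz : f (1 - z) ≠ 0) (hz' : f (1 + z) ≠ 0) :
    stayWeight f (-z) d * stayWeight f z d + swapWeight f (-z) d * swapWeight f z (-d) = 1 := by
  have h := hf.three_term_of d z 1 0 (a₁ := d + z) (a₂ := d - z) (a₃ := 1) (a₄ := 1)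
    (b₁ := d + 1) (b₂ := d - 1) (b₃ := z) (b₄ := z)
    (c₁ := d) (c₂ := d) (c₃ := 1 + z) (c₄ := -(1 - z))
    (by ring) (by ring) (by ring) (by ring) (by ring) (by ring) (by ring) (by ring)
    (by ring) (by ring) (by ring) (by ring)
  rw [hf.neg (1 - z)] at h
  simp only [hf.swapWeight_neg, hf.swapWeight_eq, stayWeight, sub_neg_eq_add, hf.neg z,
    ← sub_eq_add_neg]
  field_simp
  linear_combination h

theorem inversion_ij_ji (hf : IsWeierstrassOdd f) (d z : ℂ) :
    stayWeight f (-z) d * swapWeight f z d + swapWeight f (-z) d * stayWeight f z (-d) = 0 := by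
  simp only [hf.stayWeight_neg]
  simp only [swapWeight, stayWeight, hf.neg z, ← sub_eq_add_neg]
  ring

end IsWeierstrassOdd

/-! ### Differences of coordinates on the orbit and on the alcove -/

namespace Orbit

variable {n : ℕ}

theorem diff_add_proj (i j : Fin n) (a : Orbit n) (μ : Fin n → ℤ) :
    diff i j (a + proj n μ) = diff i j a + (μ i - μ j) := by
  rw [map_add, diff_proj]

theorem diff_swap (i j : Fin n) (a : Orbit n) : diff j i a = -diff i j a := by
  obtain ⟨lam, rfl⟩ := QuotientAddGroup.mk'_surjective _ a
  change diff j i (proj n lam) = -diff i j (proj n lam)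
  rw [diff_proj, diff_proj, neg_sub]

theorem diff_add_diff (i j k : Fin n) (a : Orbit n) : diff i j a + diff j k a = diff i k a := by
  obtain ⟨lam, rfl⟩ := QuotientAddGroup.mk'_surjective _ a
  change diff i j (proj n lam) + diff j k (proj n lam) = diff i k (proj n lam)
  rw [diff_proj, diff_proj, diff_proj, sub_add_sub_cancel]

theorem ext_of_diff {a b : Orbit n} (h : ∀ i j, diff i j a = diff i j b) : a = b := by
  obtain ⟨lam, rfl⟩ := QuotientAddGroup.mk'_surjective _ a
  obtain ⟨mu, rfl⟩ := QuotientAddGroup.mk'_surjective _ b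
  replace h : ∀ i j, lam i - lam j = mu i - mu j := h
  refine (QuotientAddGroup.mk'_eq_mk' _).mpr ?_
  rcases isEmpty_or_nonempty (Fin n) with hn | ⟨⟨i₀⟩⟩
  · exact ⟨0, zero_mem _, Subsingleton.elim _ _⟩
  · refine ⟨(mu i₀ - lam i₀) • 1, AddSubgroup.mem_zmultiples_iff.mpr ⟨_, rfl⟩, ?_⟩
    funext i
    have := h i i₀
    simp only [Pi.add_apply, Pi.smul_apply, Pi.one_apply, smul_eq_mul, mul_one]
    omega

end Orbit

/-- In the regular dominant alcove no difference `a_i - a_j` with `i ≠ j` is divisible by `r`. -/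
theorem not_dvd_diff {n r : ℕ} {a : Orbit n} (ha : a ∈ regularDominant n r) {i j : Fin n}
    (hij : i ≠ j) : ¬ (r : ℤ) ∣ Orbit.diff i j a := by
  intro hdvd
  rcases lt_or_gt_of_ne hij with h | h
  · have h1 := ha i j h
    have := Int.le_of_dvd h1.1 hdvd
    omega
  · have h1 := ha j i h
    rw [Orbit.diff_swap j i, dvd_neg] at hdvd
    have := Int.le_of_dvd h1.1 hdvd
    omega

theorem ellBracket_diff_ne_zero {τ : ℂ} (hτ : 0 < τ.im) {n r : ℕ} (hr : r ≠ 0) {a : Orbit n}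
    (ha : a ∈ regularDominant n r) {i j : Fin n} (hij : i ≠ j) :
    ellBracket τ r (Orbit.diff i j a : ℂ) ≠ 0 := fun h =>
  not_dvd_diff ha hij ((ellBracket_intCast_eq_zero_iff hτ hr _).mp h)

theorem diff_mem_Ioo {n r : ℕ} (hr : r ≠ 0) {a : Orbit n} (ha : a ∈ regularDominant n r)
    (i j : Fin n) : Orbit.diff i j a ∈ Finset.Ioo (-(r : ℤ)) r := by
  rw [Finset.mem_Ioo]
  have hs := Orbit.diff_swap i j a
  rcases lt_trichotomy i j with h | rfl | h
  · have := ha i j h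
    omega
  · omega
  · have := ha j i h
    omega

theorem finite_rsosGroupoid (n : ℕ) {r : ℕ} (hr : r ≠ 0) : Finite (RSOSGroupoid n r) := by
  let F : RSOSGroupoid n r → (Fin n × Fin n → Finset.Ioo (-(r : ℤ)) r) := fun a p =>
    ⟨Orbit.diff p.1 p.2 a.1, diff_mem_Ioo hr a.2 p.1 p.2⟩
  refine Finite.of_injective F fun a b h => Subtype.ext (Orbit.ext_of_diff fun i j => ?_)
  exact congrArg Subtype.val (congrFun h (i, j))

/-! ### The dynamical Yang–Baxter equation in coordinates -/

section Entries

variable {n : ℕ} {τ : ℂ} (r : ℕ) (z : ℂ) (a : Orbit n)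

theorem sum_matUnit_diag_apply (x y : Fin n × Fin n) :
    (∑ i : Fin n, matUnit i i ⊗ₖ matUnit i i) x y = if x = y ∧ y.1 = y.2 then 1 else 0 := by
  obtain ⟨k, l⟩ := x
  obtain ⟨i, j⟩ := y
  simp only [Matrix.sum_apply, Matrix.kroneckerMap_apply, matUnit, Matrix.single_apply]
  rw [Finset.sum_eq_single i]
  · by_cases h1 : i = k <;> by_cases h2 : i = l <;> by_cases h3 : i = j <;> simp_all [eq_comm]
  · intro b _ hb
    simp [hb]
  · simp

theorem sum_offDiag_swap_apply (c : Fin n × Fin n → ℂ) (x y : Fin n × Fin n) :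
    (∑ p ∈ (Finset.univ : Finset (Fin n)).offDiag,
      c p • (matUnit p.1 p.2 ⊗ₖ matUnit p.2 p.1)) x y =
      if x = y.swap ∧ y.1 ≠ y.2 then c y.swap else 0 := by
  obtain ⟨k, l⟩ := x
  obtain ⟨i, j⟩ := y
  simp only [Matrix.sum_apply, Matrix.smul_apply, Matrix.kroneckerMap_apply, matUnit,
    Matrix.single_apply, smul_eq_mul, Prod.swap_prod_mk]
  rcases eq_or_ne i j with rfl | hij
  · rw [if_neg (by simp)]
    refine Finset.sum_eq_zero fun p hp => ?_
    have hp' : p.1 ≠ p.2 := by simpa using hp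
    by_cases h2 : p.2 = i
    · have h1 : p.1 ≠ i := h2 ▸ hp'
      simp [h1]
    · simp [h2]
  · rw [Finset.sum_eq_single (j, i)]
    · by_cases h1 : j = k <;> by_cases h2 : i = l <;> simp_all [eq_comm]
    · rintro ⟨p, q⟩ _ hp
      by_cases h1 : p = j
      · have h2 : q ≠ i := fun h => hp (by rw [h1, h])
        simp [h2]
      · simp [h1]
    · intro h
      simp [hij.symm] at h

theorem sum_offDiag_stay_apply (c : Fin n × Fin n → ℂ) (x y : Fin n × Fin n) :
    (∑ p ∈ (Finset.univ : Finset (Fin n)).offDiag,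
      c p • (matUnit p.1 p.1 ⊗ₖ matUnit p.2 p.2)) x y =
      if x = y ∧ y.1 ≠ y.2 then c y else 0 := by
  obtain ⟨k, l⟩ := x
  obtain ⟨i, j⟩ := y
  simp only [Matrix.sum_apply, Matrix.smul_apply, Matrix.kroneckerMap_apply, matUnit,
    Matrix.single_apply, smul_eq_mul]
  rcases eq_or_ne i j with rfl | hij
  · rw [if_neg (by simp)]
    refine Finset.sum_eq_zero fun p hp => ?_
    have hp' : p.1 ≠ p.2 := by simpa using hp
    by_cases h2 : p.2 = i
    · have h1 : p.1 ≠ i := h2 ▸ hp'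
      simp [h1]
    · simp [h2]
  · rw [Finset.sum_eq_single (i, j)]
    · by_cases h1 : i = k <;> by_cases h2 : j = l <;> simp_all [eq_comm]
    · rintro ⟨p, q⟩ _ hp
      by_cases h1 : p = i
      · have h2 : q ≠ j := fun h => hp (by rw [h1, h])
        simp [h2]
      · simp [h1]
    · intro h
      simp [hij] at h

theorem ellR_apply_self (x : Fin n × Fin n) (i : Fin n) :
    ellR τ r z a x (i, i) = (Pi.single (i, i) 1 : Fin n × Fin n → ℂ) x := by
  rw [ellR, Matrix.add_apply, Matrix.sub_apply, sum_matUnit_diag_apply,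
    sum_offDiag_swap_apply, sum_offDiag_stay_apply]
  simp [Pi.single_apply]

theorem ellR_apply_of_ne (x : Fin n × Fin n) {i j : Fin n} (hij : i ≠ j) :
    ellR τ r z a x (i, j) =
      stayWeight (ellBracket τ r) z (Orbit.diff i j a) * (Pi.single (i, j) 1 : _ → ℂ) x +
      swapWeight (ellBracket τ r) z (Orbit.diff i j a) * (Pi.single (j, i) 1 : _ → ℂ) x := by
  rw [ellR, Matrix.add_apply, Matrix.sub_apply, sum_matUnit_diag_apply,
    sum_offDiag_swap_apply (fun p => _ / _), sum_offDiag_stay_apply (fun p => _ / _)]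
  have h1 : ((Orbit.diff j i a : ℤ) : ℂ) = -(Orbit.diff i j a : ℂ) := by
    rw [Orbit.diff_swap i j]
    push_cast
    rfl
  simp only [hij, and_false, if_false, ne_eq, not_false_eq_true, and_true, Prod.swap_prod_mk,
    Pi.single_apply, stayWeight, swapWeight, h1, ellBracket_neg, neg_mul, div_neg,
    zero_sub]
  rw [neg_add_eq_sub]
  split_ifs <;> ring_nf

/-- The vector `e_i ⊗ e_j ⊗ e_k`. -/
def tripleVec (i j k : Fin n) : Fin n × Fin n × Fin n → ℂ := Pi.single (i, j, k) 1

theorem dynR12_mulVec_self (i k : Fin n) :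
    (dynR12 τ r z a).mulVec (tripleVec i i k) = tripleVec i i k := by
  rw [tripleVec, Matrix.mulVec_single_one]
  funext x
  obtain ⟨p, q, s⟩ := x
  simp only [Matrix.col_apply, dynR12, ellR_apply_self, Pi.single_apply, Prod.mk.injEq]
  split_ifs <;> simp_all

theorem dynR23_mulVec_self (i j : Fin n) :
    (dynR23 τ r z a).mulVec (tripleVec i j j) = tripleVec i j j := by
  rw [tripleVec, Matrix.mulVec_single_one]
  funext x
  obtain ⟨p, q, s⟩ := x
  simp only [Matrix.col_apply, dynR23, ellR_apply_self, Pi.single_apply, Prod.mk.injEq]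
  split_ifs <;> simp_all

theorem dynR12_mulVec_of_ne {i j : Fin n} (hij : i ≠ j) (k : Fin n) :
    (dynR12 τ r z a).mulVec (tripleVec i j k) =
      stayWeight (ellBracket τ r) z (Orbit.diff i j a) • tripleVec i j k +
      swapWeight (ellBracket τ r) z (Orbit.diff i j a) • tripleVec j i k := by
  rw [tripleVec, Matrix.mulVec_single_one]
  funext x
  obtain ⟨p, q, s⟩ := x
  simp only [Matrix.col_apply, dynR12, ellR_apply_of_ne r z a _ hij, Pi.add_apply, Pi.smul_apply,
    tripleVec, Pi.single_apply, Prod.mk.injEq, smul_eq_mul]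
  by_cases hs : s = k <;> simp [hs]

theorem dynR23_mulVec_of_ne (i : Fin n) {j k : Fin n} (hjk : j ≠ k) :
    (dynR23 τ r z a).mulVec (tripleVec i j k) =
      stayWeight (ellBracket τ r) z (Orbit.diff j k (a + Orbit.proj n (eps i))) • tripleVec i j k +
      swapWeight (ellBracket τ r) z (Orbit.diff j k (a + Orbit.proj n (eps i))) •
        tripleVec i k j := by
  rw [tripleVec, Matrix.mulVec_single_one]
  funext x
  obtain ⟨p, q, s⟩ := x
  simp only [Matrix.col_apply, dynR23, ellR_apply_of_ne r z _ _ hjk, Pi.add_apply, Pi.smul_apply,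
    tripleVec, Pi.single_apply, Prod.mk.injEq, smul_eq_mul]
  by_cases hs : p = i <;> simp [hs]

end Entries

section DynamicalYangBaxter

variable {n : ℕ} {τ : ℂ} {r : ℕ} {a : Orbit n} {u v : ℂ}

/-- The dynamical Yang–Baxter equation in the space of weight `2 ε_i + ε_j`. -/
theorem dybe_two (hτ : 0 < τ.im) {i j : Fin n} (hij : i ≠ j)
    (hd : ellBracket τ r (Orbit.diff i j a : ℂ) ≠ 0)
    (hd' : ellBracket τ r ((Orbit.diff i j a : ℂ) + 1) ≠ 0)
    (hu : ellBracket τ r (1 - u) ≠ 0) (hv : ellBracket τ r (1 - v) ≠ 0)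
    (huv : ellBracket τ r (1 - (u + v)) ≠ 0) {t : Fin n × Fin n × Fin n}
    (ht : t = (i, i, j) ∨ t = (i, j, i) ∨ t = (j, i, i)) :
    (dynR23 τ r u a * dynR12 τ r (u + v) a * dynR23 τ r v a).mulVec (tripleVec t.1 t.2.1 t.2.2) =
      (dynR12 τ r v a * dynR23 τ r (u + v) a * dynR12 τ r u a).mulVec
        (tripleVec t.1 t.2.1 t.2.2) := by
  have hf := isWeierstrassOdd_ellBracket hτ r
  set d : ℂ := (Orbit.diff i j a : ℂ) with hdef
  have e1 : ((Orbit.diff j i a : ℤ) : ℂ) = -d := by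
    rw [Orbit.diff_swap i j, Int.cast_neg]
  have e2 : ((Orbit.diff i j (a + Orbit.proj n (eps i)) : ℤ) : ℂ) = d + 1 := by
    rw [Orbit.diff_add_proj]
    simp [eps, hij.symm, hdef]
  have e3 : ((Orbit.diff j i (a + Orbit.proj n (eps i)) : ℤ) : ℂ) = -(d + 1) := by
    rw [Orbit.diff_swap i j, Int.cast_neg, e2]
  have huv' : ellBracket τ r (1 - (v + u)) ≠ 0 := by rwa [add_comm v u]
  have hnd : ellBracket τ r (-d) ≠ 0 := by rwa [hf.neg, neg_ne_zero]
  have hnd' : ellBracket τ r (-(d + 1)) ≠ 0 := by rwa [hf.neg, neg_ne_zero]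
  -- exchanging the roles of `i` and `j` amounts to replacing `d` by `-(d + 1)`
  have c1 : -(d + 1) + 1 = -d := by ring
  have triv : ∀ x y p q : ℂ, swapWeight (ellBracket τ r) p x * swapWeight (ellBracket τ r) q y =
      swapWeight (ellBracket τ r) q x * swapWeight (ellBracket τ r) p y := by
    intro x y p q
    simp only [swapWeight]
    ring
  rcases ht with rfl | rfl | rfl
  · simp only [← Matrix.mulVec_mulVec, dynR12_mulVec_self, dynR23_mulVec_self,
      dynR12_mulVec_of_ne _ _ _ hij,
      dynR23_mulVec_of_ne _ _ _ _ hij, dynR23_mulVec_of_ne _ _ _ _ hij.symm,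
      Matrix.mulVec_add, Matrix.mulVec_smul, e2, e3, ← hdef]
    linear_combination (norm := module) (hf.yb_iij_iij hd hd' hu hv huv) • tripleVec i i j +
      (hf.yb_iij_iji hd hd' hu hv huv) • tripleVec i j i +
      (triv (d + 1) d v (u + v)) • tripleVec j i i
  · simp only [← Matrix.mulVec_mulVec, dynR12_mulVec_self, dynR23_mulVec_self,
      dynR12_mulVec_of_ne _ _ _ hij, dynR12_mulVec_of_ne _ _ _ hij.symm,
      dynR23_mulVec_of_ne _ _ _ _ hij, dynR23_mulVec_of_ne _ _ _ _ hij.symm,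
      Matrix.mulVec_add, Matrix.mulVec_smul, e1, e2, e3, ← hdef]
    have h := hf.yb_iji_iij hnd' (by rwa [c1]) hv hu huv'
    rw [c1, neg_neg, add_comm v u] at h
    linear_combination (norm := module) (hf.yb_iji_iij hd hd' hu hv huv) • tripleVec i i j +
      (hf.yb_iji_iji hd hd' hu hv huv) • tripleVec i j i - h • tripleVec j i i
  · simp only [← Matrix.mulVec_mulVec, dynR12_mulVec_self, dynR23_mulVec_self,
      dynR12_mulVec_of_ne _ _ _ hij, dynR12_mulVec_of_ne _ _ _ hij.symm,
      dynR23_mulVec_of_ne _ _ _ _ hij.symm,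
      Matrix.mulVec_add, Matrix.mulVec_smul, e1, e3, ← hdef]
    have h := hf.yb_iij_iij hnd' (by rwa [c1]) hv hu huv'
    have h' := hf.yb_iij_iji hnd' (by rwa [c1]) hv hu huv'
    rw [c1, neg_neg, add_comm v u] at h h'
    linear_combination (norm := module) (triv (-d) (-(d + 1)) (u + v) u) • tripleVec i i j -
      h' • tripleVec i j i - h • tripleVec j i i

/-- The dynamical Yang–Baxter equation in the space of weight `ε_i + ε_j + ε_k`. -/
theorem dybe_three (hτ : 0 < τ.im) {i j k : Fin n} (hij : i ≠ j) (hjk : j ≠ k) (hik : i ≠ k)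
    (hx : ellBracket τ r (Orbit.diff i j a : ℂ) ≠ 0)
    (hy : ellBracket τ r (Orbit.diff j k a : ℂ) ≠ 0)
    (hxy : ellBracket τ r (Orbit.diff i k a : ℂ) ≠ 0)
    (hu : ellBracket τ r (1 - u) ≠ 0) (hv : ellBracket τ r (1 - v) ≠ 0)
    (huv : ellBracket τ r (1 - (u + v)) ≠ 0) :
    (dynR23 τ r u a * dynR12 τ r (u + v) a * dynR23 τ r v a).mulVec (tripleVec i j k) =
      (dynR12 τ r v a * dynR23 τ r (u + v) a * dynR12 τ r u a).mulVec (tripleVec i j k) := by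
  have hf := isWeierstrassOdd_ellBracket hτ r
  have huv' : ellBracket τ r (1 - (v + u)) ≠ 0 := by rwa [add_comm v u]
  have e1 := Orbit.diff_swap i j a
  have e2 := Orbit.diff_swap j k a
  have e3 : Orbit.diff i k a = Orbit.diff i j a + Orbit.diff j k a :=
    (Orbit.diff_add_diff i j k a).symm
  -- the three indices being distinct, the shift of the dynamical variable is not seen
  have s1 : Orbit.diff j k (a + Orbit.proj n (eps i)) = Orbit.diff j k a := by
    rw [Orbit.diff_add_proj]
    simp [eps, hij.symm, hik.symm]
  have s2 : Orbit.diff k j (a + Orbit.proj n (eps i)) = -Orbit.diff j k a := by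
    rw [Orbit.diff_swap j k, s1]
  have s3 : Orbit.diff i k (a + Orbit.proj n (eps j)) = Orbit.diff i j a + Orbit.diff j k a := by
    rw [Orbit.diff_add_proj, e3]
    simp [eps, hij, hjk.symm]
  have s4 : Orbit.diff i j (a + Orbit.proj n (eps k)) = Orbit.diff i j a := by
    rw [Orbit.diff_add_proj]
    simp [eps, hik, hjk]
  rw [e3] at hxy
  push_cast at hxy
  simp only [← Matrix.mulVec_mulVec, dynR12_mulVec_of_ne _ _ _ hij,
      dynR12_mulVec_of_ne _ _ _ hij.symm, dynR12_mulVec_of_ne _ _ _ hik,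
      dynR12_mulVec_of_ne _ _ _ hjk,
      dynR23_mulVec_of_ne _ _ _ _ hij, dynR23_mulVec_of_ne _ _ _ _ hik,
      dynR23_mulVec_of_ne _ _ _ _ hjk, dynR23_mulVec_of_ne _ _ _ _ hjk.symm,
      Matrix.mulVec_add, Matrix.mulVec_smul, e1, e3, s1, s2, s3, s4]
  push_cast
  set x : ℂ := (Orbit.diff i j a : ℂ)
  set y : ℂ := (Orbit.diff j k a : ℂ)
  have triv : ∀ x y p q : ℂ, swapWeight (ellBracket τ r) p x * swapWeight (ellBracket τ r) q y =
      swapWeight (ellBracket τ r) q x * swapWeight (ellBracket τ r) p y := by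
    intro x y p q
    simp only [swapWeight]
    ring
  have h : stayWeight (ellBracket τ r) u x * stayWeight (ellBracket τ r) (u + v) y *
        swapWeight (ellBracket τ r) v x +
      swapWeight (ellBracket τ r) u x * stayWeight (ellBracket τ r) (u + v) (x + y) *
        stayWeight (ellBracket τ r) v (-x) =
      stayWeight (ellBracket τ r) v y * swapWeight (ellBracket τ r) (u + v) x *
        stayWeight (ellBracket τ r) u (x + y) := by
    have := hf.yb_ijk_ikj hy hx (by rwa [add_comm y x]) hv hu huv'
    rwa [add_comm v u, add_comm y x] at this
  linear_combination (norm := module) (hf.yb_ijk_ijk hx hy hxy hu hv huv) • tripleVec i j k +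
    (hf.yb_ijk_ikj hx hy hxy hu hv huv) • tripleVec i k j - h • tripleVec j i k +
    (stayWeight (ellBracket τ r) v y * triv x (x + y) (u + v) u) • tripleVec j k i +
    (stayWeight (ellBracket τ r) u x * triv y (x + y) v (u + v)) • tripleVec k i j

/-- The dynamical Yang–Baxter equation on a basis vector. Only the two ends of the path have to be
regular: the dynamical denominators are the brackets of differences of coordinates of these ends. -/
theorem dybe_tripleVec (hτ : 0 < τ.im) (hr : r ≠ 0) (ha : a ∈ regularDominant n r)
    (i j k : Fin n) (hb : a + Orbit.proj n (eps i + eps j + eps k) ∈ regularDominant n r)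
    (hu : ellBracket τ r (1 - u) ≠ 0) (hv : ellBracket τ r (1 - v) ≠ 0)
    (huv : ellBracket τ r (1 - (u + v)) ≠ 0) :
    (dynR23 τ r u a * dynR12 τ r (u + v) a * dynR23 τ r v a).mulVec (tripleVec i j k) =
      (dynR12 τ r v a * dynR23 τ r (u + v) a * dynR12 τ r u a).mulVec (tripleVec i j k) := by
  have hne : ∀ {p q : Fin n}, p ≠ q → ellBracket τ r (Orbit.diff p q a : ℂ) ≠ 0 :=
    fun h => ellBracket_diff_ne_zero hτ hr ha h
  have hne' : ∀ {p q : Fin n}, p ≠ q → eps i + eps j + eps k = eps p + eps p + eps q →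
      ellBracket τ r ((Orbit.diff p q a : ℂ) + 1) ≠ 0 := by
    intro p q h hw
    have := ellBracket_diff_ne_zero hτ hr hb h
    rw [hw, Orbit.diff_add_proj] at this
    simpa [eps, h, h.symm] using this
  rcases eq_or_ne i j with rfl | hij
  · rcases eq_or_ne i k with rfl | hik
    · simp only [← Matrix.mulVec_mulVec, dynR12_mulVec_self, dynR23_mulVec_self]
    · exact dybe_two hτ hik (hne hik) (hne' hik rfl) hu hv huv (t := (i, i, k)) (Or.inl rfl)
  · rcases eq_or_ne i k with rfl | hik
    · exact dybe_two hτ hij (hne hij) (hne' hij (add_right_comm _ _ _)) hu hv huv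
        (t := (i, j, i)) (Or.inr (Or.inl rfl))
    · rcases eq_or_ne j k with rfl | hjk
      · exact dybe_two hτ hij.symm (hne hij.symm)
          (hne' hij.symm (by rw [add_assoc, add_comm])) hu hv huv
          (t := (i, j, j)) (Or.inr (Or.inr rfl))
      · exact dybe_three hτ hij hjk hik (hne hij) (hne hjk) (hne hik) hu hv huv

theorem sum_smul_tripleVec (v : Fin n × Fin n × Fin n → ℂ) :
    v = ∑ x, v x • tripleVec x.1 x.2.1 x.2.2 := by
  simp only [tripleVec, ← Pi.single_smul', smul_eq_mul, mul_one, Prod.mk.eta]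
  exact (Finset.univ_sum_single v).symm

end DynamicalYangBaxter

/-! ### Invariance of the restricted space -/

/-- If the path `a, a + ε_i, a + ε_i + ε_j` stays in the alcove but the path
`a, a + ε_j, a + ε_i + ε_j` does not, then the weight of the transition from the first to the second
vanishes. This is why the operator preserves the restricted space. -/
theorem swapWeight_eq_zero_of_notMem {n : ℕ} {τ : ℂ} (hτ : 0 < τ.im) {r : ℕ} (hr : r ≠ 0)
    {a : Orbit n} (ha : a ∈ regularDominant n r) {i j : Fin n} (hij : i ≠ j)
    (hb : a + Orbit.proj n (eps i + eps j) ∈ regularDominant n r)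
    (hj : a + Orbit.proj n (eps j) ∉ regularDominant n r) (z : ℂ) :
    swapWeight (ellBracket τ r) z (Orbit.diff i j a) = 0 := by
  have key : (r : ℤ) ∣ 1 - Orbit.diff i j a := by
    by_contra hdvd
    apply hj
    intro p q hpq
    have h1 := ha p q hpq
    have h2 := hb p q hpq
    have hs := Orbit.diff_swap i j a
    rw [Orbit.diff_add_proj] at h2 ⊢
    simp only [eps, Pi.add_apply, Pi.single_apply] at h2 ⊢
    rcases eq_or_ne p j with rfl | hpj
    · rcases eq_or_ne q i with rfl | hqi
      · have : (1 : ℤ) - Orbit.diff q p a ≠ r := fun h => hdvd ⟨1, by rw [h, mul_one]⟩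
        simp only [hij, hij.symm, if_true, if_false] at h2 ⊢
        omega
      · simp only [hij.symm, hpq.ne', hqi, if_true, if_false] at h2 ⊢
        omega
    · rcases eq_or_ne q j with rfl | hqj
      · rcases eq_or_ne p i with rfl | hpi
        · have : (1 : ℤ) - Orbit.diff p q a ≠ 0 := fun h => hdvd (h ▸ dvd_zero _)
          simp only [hij, hij.symm, if_true, if_false] at h2 ⊢
          omega
        · simp only [hpi, hpj, hij.symm, if_true, if_false] at h2 ⊢
          omega
      · simp only [hpj, hqj, if_false] at h2 ⊢
        omega
  have := (ellBracket_intCast_eq_zero_iff hτ hr _).mpr key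
  push_cast at this
  rw [swapWeight, this, zero_mul, zero_div]


/-! ### Pure tensors in graded tensor products -/

namespace GradedVect

variable {k : Type u} [Field k] {π : Type u} [Groupoid.{u} π]

/-- The vector `x ⊗ y` of `(V ⊗ W)_γ`, for `x`, `y` in the degrees of the two factors of a
factorization of `γ`, as a bilinear map. -/
def tensorMk (V W : GradedVect k π) {a b : π} {γ : a ⟶ b} (p : Factorization γ) :
    V.carrier p.fst →ₗ[k] W.carrier p.snd →ₗ[k] (tensor V W).carrier γ :=
  TensorProduct.curry (tensorLof V W p)

theorem linearMap_ext_tensorMk {V W : GradedVect k π} {a b : π} {γ : a ⟶ b} {M : Type u}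
    [AddCommGroup M] [Module k M] {φ ψ : (tensor V W).carrier γ →ₗ[k] M}
    (h : ∀ p, (tensorMk V W p).compr₂ φ = (tensorMk V W p).compr₂ ψ) : φ = ψ := by
  classical
  exact DirectSum.linearMap_ext k fun p => TensorProduct.ext (h p)

/-- The linear map out of `(V ⊗ W)_γ` given by bilinear maps on the summands. -/
def tensorLift {V W : GradedVect k π} {a b : π} {γ : a ⟶ b} {M : Type u}
    [AddCommGroup M] [Module k M]
    (φ : ∀ p : Factorization γ, V.carrier p.fst →ₗ[k] W.carrier p.snd →ₗ[k] M) :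
    (tensor V W).carrier γ →ₗ[k] M :=
  tensorDesc V W fun p => TensorProduct.lift (φ p)

theorem tensorDesc_tensorMk {V W : GradedVect k π} {a b : π} {γ : a ⟶ b} {M : Type u}
    [AddCommGroup M] [Module k M]
    (φ : ∀ p : Factorization γ, V.carrier p.fst ⊗[k] W.carrier p.snd →ₗ[k] M)
    (p : Factorization γ) (x : V.carrier p.fst) (y : W.carrier p.snd) :
    tensorDesc V W φ (tensorMk V W p x y) = φ p (x ⊗ₜ y) := by
  classical
  exact DirectSum.toModule_lof
    (M := fun p : Factorization γ => V.carrier p.fst ⊗[k] W.carrier p.snd) k p (x ⊗ₜ y)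

theorem tensorLift_tensorMk {V W : GradedVect k π} {a b : π} {γ : a ⟶ b} {M : Type u}
    [AddCommGroup M] [Module k M]
    (φ : ∀ p : Factorization γ, V.carrier p.fst →ₗ[k] W.carrier p.snd →ₗ[k] M)
    (p : Factorization γ) (x : V.carrier p.fst) (y : W.carrier p.snd) :
    tensorLift φ (tensorMk V W p x y) = φ p x y :=
  tensorDesc_tensorMk _ p x y

theorem tensorMap_tensorMk {V V' W W' : GradedVect k π} (f : V ⟶ V') (g : W ⟶ W') {a b : π}
    {γ : a ⟶ b} (p : Factorization γ) (x : V.carrier p.fst) (y : W.carrier p.snd) :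
    Hom.app (tensorMap f g) γ (tensorMk V W p x y) =
      tensorMk V' W' p (Hom.app f p.fst x) (Hom.app g p.snd y) := by
  classical
  exact DirectSum.lmap_lof (M := fun p : Factorization γ => V.carrier p.fst ⊗[k] W.carrier p.snd)
    (fun p : Factorization γ => TensorProduct.map (Hom.app f p.fst) (Hom.app g p.snd)) p (x ⊗ₜ y)

theorem assocHom_tensorMk (U V W : GradedVect k π) {a b : π} {γ : a ⟶ b} (p : Factorization γ)
    (q : Factorization p.fst) (x : U.carrier q.fst) (y : V.carrier q.snd) (z : W.carrier p.snd) :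
    Hom.app (assocHom U V W) γ (tensorMk (tensor U V) W p (tensorMk U V q x y) z) =
    tensorMk U (tensor V W) ⟨q.mid, q.fst, q.snd ≫ p.snd, by
        rw [← Category.assoc, q.comp_eq, p.comp_eq]⟩
      x (tensorMk V W ⟨p.mid, q.snd, p.snd, rfl⟩ y z) :=
  assocHom_apply U V W p q x y z

theorem comp_app_apply {U V W : GradedVect k π} (f : U ⟶ V) (g : V ⟶ W) {a b : π} (γ : a ⟶ b)
    (x : U.carrier γ) : Hom.app (f ≫ g) γ x = Hom.app g γ (Hom.app f γ x) := rfl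

theorem id_app_apply (V : GradedVect k π) {a b : π} (γ : a ⟶ b) (x : V.carrier γ) :
    Hom.app (𝟙 V) γ x = x := rfl

theorem assocInv_assocHom (U V W : GradedVect k π) {a b : π} (γ : a ⟶ b)
    (x : (tensor (tensor U V) W).carrier γ) :
    Hom.app (assocInv U V W) γ (Hom.app (assocHom U V W) γ x) = x := by
  rw [← comp_app_apply, assoc_hom_inv, id_app_apply]

theorem hom_ext_app {V W : GradedVect k π} {f g : V ⟶ W}
    (h : ∀ {a b : π} (γ : a ⟶ b), Hom.app f γ = Hom.app g γ) : f = g :=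
  Hom.ext (by funext a b γ; exact h γ)

end GradedVect

/-! ### Paths in the restricted model -/

section Paths

variable {n r : ℕ}

/-- The basis vector `e_i` of the component of the restricted vector representation in the degree of
an arrow of weight `ε_i`. -/
def unitVec {a b : RSOSGroupoid n r} (f : a ⟶ b) (i : Fin n) (h : eps i = Orbit.weight f.hom) :
    (rsosRep n r).carrier f :=
  (Pi.single (⟨i, h⟩ : {i' : Fin n // eps i' = Orbit.weight f.hom}) (1 : ℂ) :
    {i' : Fin n // eps i' = Orbit.weight f.hom} → ℂ)

theorem linearMap_ext_unitVec {a b : RSOSGroupoid n r} {f : a ⟶ b} {M : Type} [AddCommGroup M]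
    [Module ℂ M] {φ ψ : (rsosRep n r).carrier f →ₗ[ℂ] M}
    (h : ∀ i hi, φ (unitVec f i hi) = ψ (unitVec f i hi)) : φ = ψ :=
  (Pi.basisFun ℂ {i : Fin n // eps i = Orbit.weight f.hom}).ext fun i => by
    have := h i.1 i.2
    rw [Pi.basisFun_apply]
    exact this

/-- The arrow of the restricted groupoid with given ends and weight. -/
def rsosArrow (a b : RSOSGroupoid n r) (μ : Fin n → ℤ) (h : a.1 + Orbit.proj n μ = b.1) : a ⟶ b :=
  InducedCategory.homMk (Orbit.arrow a.1 μ h)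

theorem source_add_weight {a b : RSOSGroupoid n r} (γ : a ⟶ b) :
    a.1 + Orbit.proj n (Orbit.weight γ.hom) = b.1 :=
  Subtype.property γ.hom

theorem rsosHom_ext {a b : RSOSGroupoid n r} {f g : a ⟶ b}
    (h : Orbit.weight f.hom = Orbit.weight g.hom) : f = g :=
  InducedCategory.hom_ext (Subtype.ext h)

/-- The factorization of `γ` through `a + μ`. -/
def rsosFactorization {a b : RSOSGroupoid n r} (γ : a ⟶ b) (μ ν : Fin n → ℤ)
    (hμ : a.1 + Orbit.proj n μ ∈ regularDominant n r) (h : μ + ν = Orbit.weight γ.hom) :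
    Factorization γ where
  mid := ⟨a.1 + Orbit.proj n μ, hμ⟩
  fst := rsosArrow a ⟨a.1 + Orbit.proj n μ, hμ⟩ μ rfl
  snd := rsosArrow ⟨a.1 + Orbit.proj n μ, hμ⟩ b ν (by
    change a.1 + Orbit.proj n μ + Orbit.proj n ν = b.1
    rw [add_assoc, ← map_add, h, source_add_weight])
  comp_eq := rsosHom_ext h

theorem weight_rsosFactorization_fst {a b : RSOSGroupoid n r} (γ : a ⟶ b) (μ ν : Fin n → ℤ)
    (hμ : a.1 + Orbit.proj n μ ∈ regularDominant n r) (h : μ + ν = Orbit.weight γ.hom) :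
    μ = Orbit.weight (rsosFactorization γ μ ν hμ h).fst.hom := rfl

theorem weight_rsosFactorization_snd {a b : RSOSGroupoid n r} (γ : a ⟶ b) (μ ν : Fin n → ℤ)
    (hμ : a.1 + Orbit.proj n μ ∈ regularDominant n r) (h : μ + ν = Orbit.weight γ.hom) :
    ν = Orbit.weight (rsosFactorization γ μ ν hμ h).snd.hom := rfl

theorem Factorization.weight_add {a b : RSOSGroupoid n r} {γ : a ⟶ b} (p : Factorization γ) :
    Orbit.weight p.fst.hom + Orbit.weight p.snd.hom = Orbit.weight γ.hom :=
  congrArg (fun f : a ⟶ b => Orbit.weight f.hom) p.comp_eq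

theorem Factorization.source_add_mem {a b : RSOSGroupoid n r} {γ : a ⟶ b} (p : Factorization γ) :
    a.1 + Orbit.proj n (Orbit.weight p.fst.hom) ∈ regularDominant n r := by
  rw [source_add_weight]
  exact p.mid.2

open Classical in
/-- The vector `e_i ⊗ e_j` in the degree of `γ`, read as zero if the path
`a, a + ε_i, a + ε_i + ε_j` does not stay in the alcove or does not have the ends of `γ`. -/
def rsosPath {a b : RSOSGroupoid n r} (γ : a ⟶ b) (i j : Fin n) :
    (tensor (rsosRep n r) (rsosRep n r)).carrier γ :=
  if h : a.1 + Orbit.proj n (eps i) ∈ regularDominant n r ∧ eps i + eps j = Orbit.weight γ.hom then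
    tensorMk (rsosRep n r) (rsosRep n r) (rsosFactorization γ (eps i) (eps j) h.1 h.2)
      (unitVec _ i (weight_rsosFactorization_fst γ _ _ h.1 h.2))
      (unitVec _ j (weight_rsosFactorization_snd γ _ _ h.1 h.2))
  else 0

theorem tensorMk_unitVec {a b : RSOSGroupoid n r} {γ : a ⟶ b} (p : Factorization γ) (i j : Fin n)
    (hi : eps i = Orbit.weight p.fst.hom) (hj : eps j = Orbit.weight p.snd.hom) :
    tensorMk (rsosRep n r) (rsosRep n r) p (unitVec p.fst i hi) (unitVec p.snd j hj) =
      rsosPath γ i j := by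
  have h : a.1 + Orbit.proj n (eps i) ∈ regularDominant n r ∧
      eps i + eps j = Orbit.weight γ.hom := by
    rw [hi, hj]
    exact ⟨p.source_add_mem, p.weight_add⟩
  rw [rsosPath, dif_pos h]
  obtain ⟨⟨m, hm⟩, ⟨⟨μ, hμ⟩⟩, ⟨⟨ν, hν⟩⟩, hp⟩ := p
  have hμ' : a.1 + Orbit.proj n μ = m := hμ
  subst hμ'
  have hi' : eps i = μ := hi
  have hj' : eps j = ν := hj
  subst hi'
  subst hj'
  rfl

theorem rsosPath_of_notMem {a b : RSOSGroupoid n r} (γ : a ⟶ b) {i : Fin n} (j : Fin n)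
    (h : a.1 + Orbit.proj n (eps i) ∉ regularDominant n r) : rsosPath γ i j = 0 :=
  dif_neg fun h' => h h'.1

theorem linearMap_ext_rsosPath {a b : RSOSGroupoid n r} {γ : a ⟶ b} {M : Type} [AddCommGroup M]
    [Module ℂ M] {φ ψ : (tensor (rsosRep n r) (rsosRep n r)).carrier γ →ₗ[ℂ] M}
    (h : ∀ i j, a.1 + Orbit.proj n (eps i) ∈ regularDominant n r →
      eps i + eps j = Orbit.weight γ.hom → φ (rsosPath γ i j) = ψ (rsosPath γ i j)) : φ = ψ := by
  refine linearMap_ext_tensorMk fun p => linearMap_ext_unitVec fun i hi =>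
    linearMap_ext_unitVec fun j hj => ?_
  rw [LinearMap.compr₂_apply, LinearMap.compr₂_apply, tensorMk_unitVec]
  refine h i j ?_ ?_
  · rw [hi]
    exact p.source_add_mem
  · rw [hi, hj]
    exact p.weight_add

/-! ### The operator on the restricted model -/

/-- The operator `Ř(z)` on the tensor square of the restricted vector representation. -/
def rsosR (n r : ℕ) (τ z : ℂ) :
    tensor (rsosRep n r) (rsosRep n r) ⟶ tensor (rsosRep n r) (rsosRep n r) where
  app {a _} γ := tensorDesc (rsosRep n r) (rsosRep n r) fun p =>
    (((Pi.basisFun ℂ {i : Fin n // eps i = Orbit.weight p.fst.hom}).tensorProduct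
        (Pi.basisFun ℂ {j : Fin n // eps j = Orbit.weight p.snd.hom})).constr ℂ) fun ij =>
      ∑ kl : Fin n × Fin n, ellR τ r z a.1 kl (ij.1.1, ij.2.1) • rsosPath γ kl.1 kl.2

variable (τ z : ℂ)

theorem rsosR_rsosPath {a b : RSOSGroupoid n r} (γ : a ⟶ b) {i j : Fin n}
    (hi : a.1 + Orbit.proj n (eps i) ∈ regularDominant n r)
    (hij : eps i + eps j = Orbit.weight γ.hom) :
    Hom.app (rsosR n r τ z) γ (rsosPath γ i j) =
      ∑ kl : Fin n × Fin n, ellR τ r z a.1 kl (i, j) • rsosPath γ kl.1 kl.2 := by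
  rw [← tensorMk_unitVec (rsosFactorization γ (eps i) (eps j) hi hij) i j rfl rfl]
  refine (tensorDesc_tensorMk _ _ _ _).trans ?_
  have := ((Pi.basisFun ℂ {i' : Fin n // eps i' = eps i}).tensorProduct
    (Pi.basisFun ℂ {j' : Fin n // eps j' = eps j})).constr_basis ℂ
    (fun ij => ∑ kl : Fin n × Fin n, ellR τ r z a.1 kl (ij.1.1, ij.2.1) • rsosPath γ kl.1 kl.2)
    (⟨i, rfl⟩, ⟨j, rfl⟩)
  rw [Module.Basis.tensorProduct_apply, Pi.basisFun_apply, Pi.basisFun_apply] at this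
  exact this

theorem sum_single_smul {ι M : Type*} [Fintype ι] [DecidableEq ι] [AddCommGroup M] [Module ℂ M]
    (x : ι) (w : ι → M) : ∑ y, (Pi.single x 1 : ι → ℂ) y • w y = w x := by
  rw [Finset.sum_eq_single x]
  · rw [Pi.single_eq_same, one_smul]
  · intro y _ hy
    rw [Pi.single_eq_of_ne hy, zero_smul]
  · intro h
    exact absurd (Finset.mem_univ x) h

theorem sum_ellR_self_smul {M : Type*} [AddCommGroup M] [Module ℂ M] (a : Orbit n) (i : Fin n)
    (w : Fin n × Fin n → M) : ∑ kl, ellR τ r z a kl (i, i) • w kl = w (i, i) := by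
  simp only [ellR_apply_self, sum_single_smul]

theorem sum_ellR_smul {M : Type*} [AddCommGroup M] [Module ℂ M] (a : Orbit n) {i j : Fin n}
    (hij : i ≠ j) (w : Fin n × Fin n → M) : ∑ kl, ellR τ r z a kl (i, j) • w kl =
      stayWeight (ellBracket τ r) z (Orbit.diff i j a) • w (i, j) +
      swapWeight (ellBracket τ r) z (Orbit.diff i j a) • w (j, i) := by
  simp only [ellR_apply_of_ne _ _ _ _ hij, add_smul, mul_smul, Finset.sum_add_distrib,
    ← Finset.smul_sum, sum_single_smul]

theorem rsosR_rsosPath_self {a b : RSOSGroupoid n r} (γ : a ⟶ b) {i : Fin n}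
    (hi : a.1 + Orbit.proj n (eps i) ∈ regularDominant n r)
    (hij : eps i + eps i = Orbit.weight γ.hom) :
    Hom.app (rsosR n r τ z) γ (rsosPath γ i i) = rsosPath γ i i := by
  rw [rsosR_rsosPath τ z γ hi hij,
    sum_ellR_self_smul τ z a.1 i fun kl => rsosPath γ kl.1 kl.2]

theorem rsosR_rsosPath_of_ne {a b : RSOSGroupoid n r} (γ : a ⟶ b) {i j : Fin n} (hne : i ≠ j)
    (hi : a.1 + Orbit.proj n (eps i) ∈ regularDominant n r)
    (hij : eps i + eps j = Orbit.weight γ.hom) :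
    Hom.app (rsosR n r τ z) γ (rsosPath γ i j) =
      stayWeight (ellBracket τ r) z (Orbit.diff i j a.1) • rsosPath γ i j +
      swapWeight (ellBracket τ r) z (Orbit.diff i j a.1) • rsosPath γ j i := by
  rw [rsosR_rsosPath τ z γ hi hij,
    sum_ellR_smul τ z a.1 hne fun kl => rsosPath γ kl.1 kl.2]

end Paths

section Restriction

variable {n r : ℕ} {τ : ℂ}

theorem restrictTensorIncl_rsosPath {a b : RSOSGroupoid n r} (γ : a ⟶ b) {i j : Fin n}
    (hi : a.1 + Orbit.proj n (eps i) ∈ regularDominant n r)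
    (hij : eps i + eps j = Orbit.weight γ.hom) :
    restrictTensorIncl (vectorRep n) (vectorRep n) (regularDominant n r) γ (rsosPath γ i j) =
      pathVector γ.hom i j hij := by
  rw [← tensorMk_unitVec (rsosFactorization γ (eps i) (eps j) hi hij) i j rfl rfl]
  exact tensorDesc_tensorMk _ _ _ _

theorem ellROp_pathVector (z : ℂ) {a b : Orbit n} (γ : a ⟶ b) (i j : Fin n)
    (hij : eps i + eps j = Orbit.weight γ) :
    Hom.app (ellROp n r τ z) γ (pathVector γ i j hij) =
      ∑ kl : {kl : Fin n × Fin n // eps kl.1 + eps kl.2 = Orbit.weight γ},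
        ellR τ r z a kl.1 (i, j) • pathVector γ kl.1.1 kl.1.2 kl.2 := by
  refine (tensorDesc_tensorMk _ _ _ _).trans ?_
  have := ((Pi.basisFun ℂ {i' : Fin n // eps i' = eps i}).tensorProduct
    (Pi.basisFun ℂ {j' : Fin n // eps j' = eps j})).constr_basis ℂ
    (fun ij => ∑ kl : {kl : Fin n × Fin n // eps kl.1 + eps kl.2 = Orbit.weight γ},
        ellR τ r z a kl.1 (ij.1.1, ij.2.1) • pathVector γ kl.1.1 kl.1.2 kl.2)
    (⟨i, rfl⟩, ⟨j, rfl⟩)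
  rw [Module.Basis.tensorProduct_apply, Pi.basisFun_apply, Pi.basisFun_apply] at this
  exact this

theorem sum_subtype_single_smul {ι M : Type*} [DecidableEq ι] {P : ι → Prop}
    [Fintype {y // P y}] [AddCommGroup M] [Module ℂ M] (x : {y // P y}) (w : {y // P y} → M) :
    ∑ y : {y // P y}, (Pi.single x.1 1 : ι → ℂ) y.1 • w y = w x := by
  rw [Finset.sum_eq_single x]
  · rw [Pi.single_eq_same, one_smul]
  · intro y _ hy
    rw [Pi.single_eq_of_ne (fun h => hy (Subtype.ext h)), zero_smul]
  · intro h
    exact absurd (Finset.mem_univ x) h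

theorem ellROp_pathVector_self (z : ℂ) {a b : Orbit n} (γ : a ⟶ b) (i : Fin n)
    (hij : eps i + eps i = Orbit.weight γ) :
    Hom.app (ellROp n r τ z) γ (pathVector γ i i hij) = pathVector γ i i hij := by
  rw [ellROp_pathVector]
  simp only [ellR_apply_self]
  exact sum_subtype_single_smul (P := fun kl : Fin n × Fin n => eps kl.1 + eps kl.2 = _)
    ⟨(i, i), hij⟩ fun kl => pathVector γ kl.1.1 kl.1.2 kl.2

theorem ellROp_pathVector_of_ne (z : ℂ) {a b : Orbit n} (γ : a ⟶ b) {i j : Fin n} (hne : i ≠ j)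
    (hij : eps i + eps j = Orbit.weight γ) :
    Hom.app (ellROp n r τ z) γ (pathVector γ i j hij) =
      stayWeight (ellBracket τ r) z (Orbit.diff i j a) • pathVector γ i j hij +
      swapWeight (ellBracket τ r) z (Orbit.diff i j a) •
        pathVector γ j i ((add_comm _ _).trans hij) := by
  rw [ellROp_pathVector]
  simp only [ellR_apply_of_ne _ _ _ _ hne, add_smul, mul_smul, Finset.sum_add_distrib,
    ← Finset.smul_sum]
  congr 2
  · exact sum_subtype_single_smul (P := fun kl : Fin n × Fin n => eps kl.1 + eps kl.2 = _)
      ⟨(i, j), hij⟩ fun kl => pathVector γ kl.1.1 kl.1.2 kl.2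
  · exact sum_subtype_single_smul (P := fun kl : Fin n × Fin n => eps kl.1 + eps kl.2 = _)
      ⟨(j, i), (add_comm _ _).trans hij⟩ fun kl => pathVector γ kl.1.1 kl.1.2 kl.2

theorem target_mem {a b : RSOSGroupoid n r} (γ : a ⟶ b) {μ : Fin n → ℤ}
    (h : μ = Orbit.weight γ.hom) : a.1 + Orbit.proj n μ ∈ regularDominant n r := by
  rw [h, source_add_weight]
  exact b.2

theorem isRestriction_rsosR (hτ : 0 < τ.im) (hr : r ≠ 0) (z : ℂ) :
    IsRestriction (ellROp n r τ z) (rsosR n r τ z) := by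
  intro a b γ x
  suffices h : (Hom.app (ellROp n r τ z) γ.hom) ∘ₗ
      restrictTensorIncl (vectorRep n) (vectorRep n) (regularDominant n r) γ =
      restrictTensorIncl (vectorRep n) (vectorRep n) (regularDominant n r) γ ∘ₗ
        Hom.app (rsosR n r τ z) γ from LinearMap.congr_fun h x
  refine linearMap_ext_rsosPath fun i j hi hij => ?_
  let I : (tensor (rsosRep n r) (rsosRep n r)).carrier γ →ₗ[ℂ]
      (tensor (vectorRep n) (vectorRep n)).carrier γ.hom :=
    restrictTensorIncl (vectorRep n) (vectorRep n) (regularDominant n r) γ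
  let L := Hom.app (ellROp n r τ z) γ.hom
  change L (I (rsosPath γ i j)) = I (Hom.app (rsosR n r τ z) γ (rsosPath γ i j))
  have hI : ∀ {i j : Fin n} (_ : a.1 + Orbit.proj n (eps i) ∈ regularDominant n r)
      (hij : eps i + eps j = Orbit.weight γ.hom), I (rsosPath γ i j) = pathVector γ.hom i j hij :=
    fun hi hij => restrictTensorIncl_rsosPath γ hi hij
  rcases eq_or_ne i j with rfl | hne
  · rw [rsosR_rsosPath_self τ z γ hi hij, hI hi hij]
    exact ellROp_pathVector_self z γ.hom i hij
  · have hji : eps j + eps i = Orbit.weight γ.hom := (add_comm _ _).trans hij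
    have hs : swapWeight (ellBracket τ r) z (Orbit.diff i j a.1) • I (rsosPath γ j i) =
        swapWeight (ellBracket τ r) z (Orbit.diff i j a.1) • pathVector γ.hom j i hji := by
      by_cases hj : a.1 + Orbit.proj n (eps j) ∈ regularDominant n r
      · rw [hI hj hji]
      · rw [swapWeight_eq_zero_of_notMem hτ hr a.2 hne (target_mem γ hij) hj, zero_smul, zero_smul]
    rw [rsosR_rsosPath_of_ne τ z γ hne hi hij, map_add, map_smul, map_smul, hI hi hij, hs]
    exact ellROp_pathVector_of_ne z γ.hom hne hij

/-! ### Regularity -/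

/-- The matrix entries of the restricted operator are combinations of the weights at regular values
of the dynamical variable. -/
theorem rsosR_entry_mem (hτ : 0 < τ.im) (hr : r ≠ 0) (S : Submodule ℂ (ℂ → ℂ))
    (hconst : ∀ c : ℂ, (fun _ => c) ∈ S)
    (hstay : ∀ d, ellBracket τ r d ≠ 0 → (fun z => stayWeight (ellBracket τ r) z d) ∈ S)
    (hswap : ∀ d, ellBracket τ r d ≠ 0 → (fun z => swapWeight (ellBracket τ r) z d) ∈ S)
    {a b : RSOSGroupoid n r} (γ : a ⟶ b) (x : (tensor (rsosRep n r) (rsosRep n r)).carrier γ)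
    (l : (tensor (rsosRep n r) (rsosRep n r)).carrier γ →ₗ[ℂ] ℂ) :
    (fun z => l (Hom.app (rsosR n r τ z) γ x)) ∈ S := by
  let T : (tensor (rsosRep n r) (rsosRep n r)).carrier γ →ₗ[ℂ] (ℂ → ℂ) :=
    LinearMap.pi fun z => l ∘ₗ Hom.app (rsosR n r τ z) γ
  suffices h : S.mkQ ∘ₗ T = 0 by
    have := LinearMap.congr_fun h x
    exact (Submodule.Quotient.mk_eq_zero S).mp this
  refine linearMap_ext_rsosPath fun i j hi hij => (Submodule.Quotient.mk_eq_zero S).mpr ?_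
  rcases eq_or_ne i j with rfl | hne
  · have : T (rsosPath γ i i) = fun _ => l (rsosPath γ i i) := by
      funext z
      exact congrArg l (rsosR_rsosPath_self τ z γ hi hij)
    rw [this]
    exact hconst _
  · have hd := ellBracket_diff_ne_zero hτ hr a.2 hne
    have : T (rsosPath γ i j) =
        l (rsosPath γ i j) • (fun z => stayWeight (ellBracket τ r) z (Orbit.diff i j a.1)) +
        l (rsosPath γ j i) • (fun z => swapWeight (ellBracket τ r) z (Orbit.diff i j a.1)) := by
      funext z
      refine (congrArg l (rsosR_rsosPath_of_ne τ z γ hne hi hij)).trans ?_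
      rw [map_add, map_smul, map_smul]
      simp only [Pi.add_apply, Pi.smul_apply, smul_eq_mul]
      ring
    rw [this]
    exact S.add_mem (S.smul_mem _ (hstay _ hd)) (S.smul_mem _ (hswap _ hd))

theorem analyticAt_stayWeight (hτ : 0 < τ.im) {z d : ℂ} (hd : ellBracket τ r d ≠ 0)
    (hz : ellBracket τ r (1 - z) ≠ 0) :
    AnalyticAt ℂ (fun z => stayWeight (ellBracket τ r) z d) z := by
  have h := differentiable_ellBracket hτ r
  refine AnalyticAt.div ?_ ?_ (mul_ne_zero hd hz)
  · exact Differentiable.analyticAt (by fun_prop) z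
  · exact Differentiable.analyticAt (by fun_prop) z

theorem analyticAt_swapWeight (hτ : 0 < τ.im) {z d : ℂ} (hd : ellBracket τ r d ≠ 0)
    (hz : ellBracket τ r (1 - z) ≠ 0) :
    AnalyticAt ℂ (fun z => swapWeight (ellBracket τ r) z d) z := by
  have h := differentiable_ellBracket hτ r
  refine AnalyticAt.div ?_ ?_ (mul_ne_zero hd hz)
  · exact Differentiable.analyticAt (by fun_prop) z
  · exact Differentiable.analyticAt (by fun_prop) z

theorem meromorphic_stayWeight (hτ : 0 < τ.im) (d : ℂ) :
    Meromorphic fun z => stayWeight (ellBracket τ r) z d := by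
  have h := differentiable_ellBracket hτ r
  intro z
  refine MeromorphicAt.div (AnalyticAt.meromorphicAt ?_) (AnalyticAt.meromorphicAt ?_)
  · exact Differentiable.analyticAt (by fun_prop) z
  · exact Differentiable.analyticAt (by fun_prop) z

theorem meromorphic_swapWeight (hτ : 0 < τ.im) (d : ℂ) :
    Meromorphic fun z => swapWeight (ellBracket τ r) z d := by
  have h := differentiable_ellBracket hτ r
  intro z
  refine MeromorphicAt.div (AnalyticAt.meromorphicAt ?_) (AnalyticAt.meromorphicAt ?_)
  · exact Differentiable.analyticAt (by fun_prop) z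
  · exact Differentiable.analyticAt (by fun_prop) z

theorem regularAt_rsosR (hτ : 0 < τ.im) (hr : r ≠ 0) {z : ℂ} (hz : ellBracket τ r (1 - z) ≠ 0) :
    RegularAt (rsosR n r τ) z := by
  intro a b γ x l
  exact rsosR_entry_mem hτ hr
    { carrier := {f | AnalyticAt ℂ f z}
      add_mem' := fun hf hg => hf.add hg
      zero_mem' := analyticAt_const
      smul_mem' := fun c f hf => analyticAt_const.smul hf }
    (fun _ => analyticAt_const) (fun d hd => analyticAt_stayWeight hτ hd hz)
    (fun d hd => analyticAt_swapWeight hτ hd hz) γ x l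

theorem meromorphicFamily_rsosR (hτ : 0 < τ.im) (hr : r ≠ 0) :
    MeromorphicFamily (rsosR n r τ) := by
  intro a b γ x l
  exact rsosR_entry_mem hτ hr
    { carrier := {f | Meromorphic f}
      add_mem' := fun hf hg => hf.add hg
      zero_mem' := fun z => MeromorphicAt.const 0 z
      smul_mem' := fun c f hf z => (MeromorphicAt.const c z).smul (hf z) }
    (fun c z => MeromorphicAt.const c z) (fun d _ => meromorphic_stayWeight hτ d)
    (fun d _ => meromorphic_swapWeight hτ d) γ x l

/-! ### The inversion relation -/

theorem rsosR_inversion (hτ : 0 < τ.im) (hr : r ≠ 0) {z : ℂ} (hz : ellBracket τ r (1 - z) ≠ 0)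
    (hz' : ellBracket τ r (1 - -z) ≠ 0) :
    rsosR n r τ (-z) ≫ rsosR n r τ z = 𝟙 (tensor (rsosRep n r) (rsosRep n r)) := by
  have hf := isWeierstrassOdd_ellBracket hτ r
  rw [sub_neg_eq_add] at hz'
  refine hom_ext_app fun {a b} γ => linearMap_ext_rsosPath fun i j hi hij => ?_
  rw [comp_app_apply, id_app_apply]
  rcases eq_or_ne i j with rfl | hne
  · rw [rsosR_rsosPath_self τ (-z) γ hi hij, rsosR_rsosPath_self τ z γ hi hij]
  · have hji : eps j + eps i = Orbit.weight γ.hom := (add_comm _ _).trans hij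
    have e1 : ((Orbit.diff j i a.1 : ℤ) : ℂ) = -(Orbit.diff i j a.1 : ℂ) := by
      rw [Orbit.diff_swap i j, Int.cast_neg]
    have h1 := hf.inversion_ij_ij (ellBracket_diff_ne_zero hτ hr a.2 hne) hz hz'
    have h2 := hf.inversion_ij_ji (Orbit.diff i j a.1) z
    have hs : Hom.app (rsosR n r τ z) γ
        (swapWeight (ellBracket τ r) (-z) (Orbit.diff i j a.1) • rsosPath γ j i) =
        swapWeight (ellBracket τ r) (-z) (Orbit.diff i j a.1) •
          (stayWeight (ellBracket τ r) z (-(Orbit.diff i j a.1 : ℂ)) • rsosPath γ j i +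
            swapWeight (ellBracket τ r) z (-(Orbit.diff i j a.1 : ℂ)) • rsosPath γ i j) := by
      by_cases hj : a.1 + Orbit.proj n (eps j) ∈ regularDominant n r
      · rw [map_smul, rsosR_rsosPath_of_ne τ z γ hne.symm hj hji, e1]
      · rw [swapWeight_eq_zero_of_notMem hτ hr a.2 hne (target_mem γ hij) hj, zero_smul, zero_smul,
          map_zero]
    rw [rsosR_rsosPath_of_ne τ (-z) γ hne hi hij, map_add, map_smul,
      rsosR_rsosPath_of_ne τ z γ hne hi hij, hs]
    linear_combination (norm := module) h1 • rsosPath γ i j + h2 • rsosPath γ j i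

end Restriction

/-! ### The Yang–Baxter equation on the restricted model -/

section Triples

variable {n r : ℕ} {τ : ℂ}

open Classical in
/-- The vector `(e_i ⊗ e_j) ⊗ e_k` in the degree of `γ`, read as zero if the path
`a, a + ε_i, a + ε_i + ε_j, a + ε_i + ε_j + ε_k` does not stay in the alcove or does not have the
ends of `γ`. -/
def rsosTriple {a b : RSOSGroupoid n r} (γ : a ⟶ b) (i j k : Fin n) :
    (tensor (tensor (rsosRep n r) (rsosRep n r)) (rsosRep n r)).carrier γ :=
  if h : a.1 + Orbit.proj n (eps i + eps j) ∈ regularDominant n r ∧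
      eps i + eps j + eps k = Orbit.weight γ.hom then
    tensorMk (tensor (rsosRep n r) (rsosRep n r)) (rsosRep n r)
      (rsosFactorization γ (eps i + eps j) (eps k) h.1 h.2)
      (rsosPath _ i j)
      (unitVec _ k (weight_rsosFactorization_snd γ _ _ h.1 h.2))
  else 0

open Classical in
/-- The vector `e_i ⊗ (e_j ⊗ e_k)` in the degree of `γ`, with the same convention as for
`rsosTriple`. -/
def rsosTriple' {a b : RSOSGroupoid n r} (γ : a ⟶ b) (i j k : Fin n) :
    (tensor (rsosRep n r) (tensor (rsosRep n r) (rsosRep n r))).carrier γ :=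
  if h : a.1 + Orbit.proj n (eps i) ∈ regularDominant n r ∧
      eps i + (eps j + eps k) = Orbit.weight γ.hom then
    tensorMk (rsosRep n r) (tensor (rsosRep n r) (rsosRep n r))
      (rsosFactorization γ (eps i) (eps j + eps k) h.1 h.2)
      (unitVec _ i (weight_rsosFactorization_fst γ _ _ h.1 h.2))
      (rsosPath _ j k)
  else 0

theorem tensorMk_rsosPath_unitVec {a b : RSOSGroupoid n r} {γ : a ⟶ b} (p : Factorization γ)
    (i j k : Fin n) (hij : eps i + eps j = Orbit.weight p.fst.hom)
    (hk : eps k = Orbit.weight p.snd.hom) :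
    tensorMk (tensor (rsosRep n r) (rsosRep n r)) (rsosRep n r) p (rsosPath p.fst i j)
      (unitVec p.snd k hk) = rsosTriple γ i j k := by
  have h : a.1 + Orbit.proj n (eps i + eps j) ∈ regularDominant n r ∧
      eps i + eps j + eps k = Orbit.weight γ.hom := by
    rw [hij, hk]
    exact ⟨p.source_add_mem, p.weight_add⟩
  rw [rsosTriple, dif_pos h]
  obtain ⟨⟨m, hm⟩, ⟨⟨μ, hμ⟩⟩, ⟨⟨ν, hν⟩⟩, hp⟩ := p
  have hμ' : a.1 + Orbit.proj n μ = m := hμ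
  subst hμ'
  have hi' : eps i + eps j = μ := hij
  have hj' : eps k = ν := hk
  subst hi'
  subst hj'
  rfl

theorem tensorMk_unitVec_rsosPath {a b : RSOSGroupoid n r} {γ : a ⟶ b} (p : Factorization γ)
    (i j k : Fin n) (hi : eps i = Orbit.weight p.fst.hom)
    (hjk : eps j + eps k = Orbit.weight p.snd.hom) :
    tensorMk (rsosRep n r) (tensor (rsosRep n r) (rsosRep n r)) p (unitVec p.fst i hi)
      (rsosPath p.snd j k) = rsosTriple' γ i j k := by
  have h : a.1 + Orbit.proj n (eps i) ∈ regularDominant n r ∧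
      eps i + (eps j + eps k) = Orbit.weight γ.hom := by
    rw [hi, hjk]
    exact ⟨p.source_add_mem, p.weight_add⟩
  rw [rsosTriple', dif_pos h]
  obtain ⟨⟨m, hm⟩, ⟨⟨μ, hμ⟩⟩, ⟨⟨ν, hν⟩⟩, hp⟩ := p
  have hμ' : a.1 + Orbit.proj n μ = m := hμ
  subst hμ'
  have hi' : eps i = μ := hi
  have hj' : eps j + eps k = ν := hjk
  subst hi'
  subst hj'
  rfl

/-- The path `a, a + ε_i, a + ε_i + ε_j, a + ε_i + ε_j + ε_k` stays in the alcove and has the ends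
of `γ`. -/
structure IsRSOSTriple {a b : RSOSGroupoid n r} (γ : a ⟶ b) (i j k : Fin n) : Prop where
  fst_mem : a.1 + Orbit.proj n (eps i) ∈ regularDominant n r
  snd_mem : a.1 + Orbit.proj n (eps i + eps j) ∈ regularDominant n r
  weight_eq : eps i + eps j + eps k = Orbit.weight γ.hom

theorem rsosTriple_eq_zero {a b : RSOSGroupoid n r} {γ : a ⟶ b} {i j k : Fin n}
    (h : ¬ IsRSOSTriple γ i j k) : rsosTriple γ i j k = 0 := by
  rw [rsosTriple]
  split_ifs with h'
  · rw [rsosPath_of_notMem _ _ fun hi => h ⟨hi, h'.1, h'.2⟩, map_zero, LinearMap.zero_apply]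
  · rfl

theorem rsosTriple'_eq_zero {a b : RSOSGroupoid n r} {γ : a ⟶ b} {i j k : Fin n}
    (h : ¬ IsRSOSTriple γ i j k) : rsosTriple' γ i j k = 0 := by
  rw [rsosTriple']
  split_ifs with h'
  · rw [rsosPath_of_notMem, map_zero]
    intro hj
    refine h ⟨h'.1, ?_, (add_assoc _ _ _).trans h'.2⟩
    rw [map_add, ← add_assoc]
    exact hj
  · rfl

theorem assocHom_rsosTriple {a b : RSOSGroupoid n r} (γ : a ⟶ b) (i j k : Fin n) :
    Hom.app (assocHom (rsosRep n r) (rsosRep n r) (rsosRep n r)) γ (rsosTriple γ i j k) =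
      rsosTriple' γ i j k := by
  by_cases h : IsRSOSTriple γ i j k
  · obtain ⟨h1, h2, h3⟩ := h
    let p := rsosFactorization γ (eps i + eps j) (eps k) h2 h3
    let q := rsosFactorization p.fst (eps i) (eps j) h1 rfl
    have hi : eps i = Orbit.weight q.fst.hom := rfl
    have hj : eps j = Orbit.weight q.snd.hom := rfl
    have hk : eps k = Orbit.weight p.snd.hom := rfl
    rw [← tensorMk_rsosPath_unitVec p i j k rfl hk, ← tensorMk_unitVec q i j hi hj,
      assocHom_tensorMk]
    refine (congrArg (tensorMk _ _ _ _) (tensorMk_unitVec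
      (⟨p.mid, q.snd, p.snd, rfl⟩ : Factorization (q.snd ≫ p.snd)) j k hj hk)).trans ?_
    exact tensorMk_unitVec_rsosPath ⟨q.mid, q.fst, q.snd ≫ p.snd, _⟩ i j k hi rfl
  · rw [rsosTriple_eq_zero h, rsosTriple'_eq_zero h, map_zero]

theorem linearMap_ext_rsosTriple {a b : RSOSGroupoid n r} {γ : a ⟶ b} {M : Type} [AddCommGroup M]
    [Module ℂ M]
    {φ ψ : (tensor (tensor (rsosRep n r) (rsosRep n r)) (rsosRep n r)).carrier γ →ₗ[ℂ] M}
    (h : ∀ i j k, IsRSOSTriple γ i j k → φ (rsosTriple γ i j k) = ψ (rsosTriple γ i j k)) :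
    φ = ψ := by
  refine linearMap_ext_tensorMk fun p => linearMap_ext_rsosPath fun i j hi hij =>
    linearMap_ext_unitVec fun k hk => ?_
  rw [LinearMap.compr₂_apply, LinearMap.compr₂_apply, tensorMk_rsosPath_unitVec p i j k hij hk]
  refine h i j k ⟨hi, ?_, ?_⟩
  · rw [hij]
    exact p.source_add_mem
  · rw [hij, hk]
    exact p.weight_add

variable (z : ℂ)

theorem act12_rsosTriple_self {a b : RSOSGroupoid n r} {γ : a ⟶ b} {i k : Fin n}
    (h : IsRSOSTriple γ i i k) :
    Hom.app (act12 (rsosR n r τ z)) γ (rsosTriple γ i i k) = rsosTriple γ i i k := by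
  let p := rsosFactorization γ (eps i + eps i) (eps k) h.snd_mem h.weight_eq
  rw [← tensorMk_rsosPath_unitVec p i i k rfl rfl, act12, tensorMap_tensorMk, id_app_apply,
    rsosR_rsosPath_self τ z p.fst h.fst_mem rfl]

theorem act12_rsosTriple_of_ne {a b : RSOSGroupoid n r} {γ : a ⟶ b} {i j k : Fin n} (hne : i ≠ j)
    (h : IsRSOSTriple γ i j k) :
    Hom.app (act12 (rsosR n r τ z)) γ (rsosTriple γ i j k) =
      stayWeight (ellBracket τ r) z (Orbit.diff i j a.1) • rsosTriple γ i j k +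
      swapWeight (ellBracket τ r) z (Orbit.diff i j a.1) • rsosTriple γ j i k := by
  let p := rsosFactorization γ (eps i + eps j) (eps k) h.snd_mem h.weight_eq
  rw [← tensorMk_rsosPath_unitVec p i j k rfl rfl,
    ← tensorMk_rsosPath_unitVec p j i k (add_comm _ _) rfl, act12, tensorMap_tensorMk,
    id_app_apply, rsosR_rsosPath_of_ne τ z p.fst hne h.fst_mem rfl, map_add, map_smul, map_smul,
    LinearMap.add_apply, LinearMap.smul_apply, LinearMap.smul_apply]

theorem act23_rsosTriple {a b : RSOSGroupoid n r} {γ : a ⟶ b} {i j k : Fin n}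
    {w : (tensor (tensor (rsosRep n r) (rsosRep n r)) (rsosRep n r)).carrier γ}
    (hw : Hom.app (tensorMap (𝟙 (rsosRep n r)) (rsosR n r τ z)) γ (rsosTriple' γ i j k) =
      Hom.app (assocHom (rsosRep n r) (rsosRep n r) (rsosRep n r)) γ w) :
    Hom.app (act23 (rsosR n r τ z)) γ (rsosTriple γ i j k) = w := by
  rw [act23, comp_app_apply, comp_app_apply]
  change Hom.app (assocInv _ _ _) γ (Hom.app (tensorMap _ _) γ
    (Hom.app (assocHom _ _ _) γ (rsosTriple γ i j k))) = w
  rw [assocHom_rsosTriple, hw, assocInv_assocHom]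

theorem IsRSOSTriple.mid_add_mem {a b : RSOSGroupoid n r} {γ : a ⟶ b} {i j k : Fin n}
    (h : IsRSOSTriple γ i j k) :
    a.1 + Orbit.proj n (eps i) + Orbit.proj n (eps j) ∈ regularDominant n r := by
  rw [add_assoc, ← map_add]
  exact h.snd_mem

theorem act23_rsosTriple_self {a b : RSOSGroupoid n r} {γ : a ⟶ b} {i j : Fin n}
    (h : IsRSOSTriple γ i j j) :
    Hom.app (act23 (rsosR n r τ z)) γ (rsosTriple γ i j j) = rsosTriple γ i j j := by
  let p := rsosFactorization γ (eps i) (eps j + eps j) h.fst_mem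
    ((add_assoc _ _ _).symm.trans h.weight_eq)
  apply act23_rsosTriple z
  rw [assocHom_rsosTriple, ← tensorMk_unitVec_rsosPath p i j j rfl rfl, tensorMap_tensorMk,
    id_app_apply, rsosR_rsosPath_self τ z p.snd h.mid_add_mem rfl]

theorem act23_rsosTriple_of_ne {a b : RSOSGroupoid n r} {γ : a ⟶ b} {i j k : Fin n} (hne : j ≠ k)
    (h : IsRSOSTriple γ i j k) :
    Hom.app (act23 (rsosR n r τ z)) γ (rsosTriple γ i j k) =
      stayWeight (ellBracket τ r) z (Orbit.diff j k (a.1 + Orbit.proj n (eps i))) •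
        rsosTriple γ i j k +
      swapWeight (ellBracket τ r) z (Orbit.diff j k (a.1 + Orbit.proj n (eps i))) •
        rsosTriple γ i k j := by
  let p := rsosFactorization γ (eps i) (eps j + eps k) h.fst_mem
    ((add_assoc _ _ _).symm.trans h.weight_eq)
  apply act23_rsosTriple z
  rw [map_add, map_smul, map_smul, assocHom_rsosTriple, assocHom_rsosTriple,
    ← tensorMk_unitVec_rsosPath p i j k rfl rfl,
    ← tensorMk_unitVec_rsosPath p i k j rfl (add_comm _ _), tensorMap_tensorMk,
    id_app_apply, rsosR_rsosPath_of_ne τ z p.snd hne h.mid_add_mem rfl, map_add, map_smul, map_smul]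
  rfl

/-- The coordinate map from `ℂⁿ ⊗ ℂⁿ ⊗ ℂⁿ` onto the component of the third tensor power in the
degree of `γ`. -/
def tripleMap {a b : RSOSGroupoid n r} (γ : a ⟶ b) :
    (Fin n × Fin n × Fin n → ℂ) →ₗ[ℂ]
      (tensor (tensor (rsosRep n r) (rsosRep n r)) (rsosRep n r)).carrier γ :=
  Fintype.linearCombination ℂ fun x => rsosTriple γ x.1 x.2.1 x.2.2

theorem tripleMap_tripleVec {a b : RSOSGroupoid n r} (γ : a ⟶ b) (i j k : Fin n) :
    tripleMap γ (tripleVec i j k) = rsosTriple γ i j k := by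
  rw [tripleMap, tripleVec, Fintype.linearCombination_apply_single, one_smul]

/-- The span of the `e_i ⊗ e_j ⊗ e_k` for which the corresponding path stays in the alcove and has
the ends of `γ`. -/
def tripleSpan {a b : RSOSGroupoid n r} (γ : a ⟶ b) :
    Submodule ℂ (Fin n × Fin n × Fin n → ℂ) :=
  Submodule.span ℂ {v | ∃ i j k, IsRSOSTriple γ i j k ∧ tripleVec i j k = v}

theorem tripleVec_mem {a b : RSOSGroupoid n r} {γ : a ⟶ b} {i j k : Fin n}
    (h : IsRSOSTriple γ i j k) : tripleVec i j k ∈ tripleSpan γ :=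
  Submodule.subset_span ⟨i, j, k, h, rfl⟩

theorem smul_tripleVec_mem {a b : RSOSGroupoid n r} {γ : a ⟶ b} {i j k : Fin n} {c : ℂ}
    (h : IsRSOSTriple γ i j k ∨ c = 0) : c • tripleVec i j k ∈ tripleSpan γ := by
  rcases h with h | rfl
  · exact Submodule.smul_mem _ _ (tripleVec_mem h)
  · rw [zero_smul]
    exact Submodule.zero_mem _

/-- On the admissible subspace the coordinate matrix of `Ř(z)^(12)` is `dynR12`, and this subspace
is invariant. -/
theorem act12_tripleMap (hτ : 0 < τ.im) (hr : r ≠ 0) {a b : RSOSGroupoid n r} {γ : a ⟶ b}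
    {v : Fin n × Fin n × Fin n → ℂ} (hv : v ∈ tripleSpan γ) :
    (dynR12 τ r z a.1).mulVec v ∈ tripleSpan γ ∧
      Hom.app (act12 (rsosR n r τ z)) γ (tripleMap γ v) =
        tripleMap γ ((dynR12 τ r z a.1).mulVec v) := by
  induction hv using Submodule.span_induction with
  | mem v hv =>
    obtain ⟨i, j, k, h, rfl⟩ := hv
    rw [tripleMap_tripleVec]
    rcases eq_or_ne i j with rfl | hne
    · rw [dynR12_mulVec_self, tripleMap_tripleVec]
      exact ⟨tripleVec_mem h, act12_rsosTriple_self z h⟩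
    · rw [dynR12_mulVec_of_ne _ _ _ hne]
      refine ⟨Submodule.add_mem _ (smul_tripleVec_mem (Or.inl h)) (smul_tripleVec_mem ?_), ?_⟩
      · by_cases hj : a.1 + Orbit.proj n (eps j) ∈ regularDominant n r
        · refine Or.inl ⟨hj, ?_, ?_⟩
          · rw [add_comm (eps j)]
            exact h.snd_mem
          · rw [add_comm (eps j)]
            exact h.weight_eq
        · exact Or.inr (swapWeight_eq_zero_of_notMem hτ hr a.2 hne h.snd_mem hj z)
      · rw [act12_rsosTriple_of_ne z hne h, (tripleMap γ).map_add, (tripleMap γ).map_smul,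
          (tripleMap γ).map_smul, tripleMap_tripleVec, tripleMap_tripleVec]
  | zero =>
    rw [Matrix.mulVec_zero, map_zero, map_zero]
    exact ⟨Submodule.zero_mem _, rfl⟩
  | add v w _ _ hv hw =>
    rw [Matrix.mulVec_add, map_add, map_add, map_add, hv.2, hw.2]
    exact ⟨Submodule.add_mem _ hv.1 hw.1, rfl⟩
  | smul c v _ hv =>
    rw [Matrix.mulVec_smul, map_smul, map_smul, map_smul, hv.2]
    exact ⟨Submodule.smul_mem _ _ hv.1, rfl⟩

/-- On the admissible subspace the coordinate matrix of `Ř(z)^(23)` is `dynR23`, and this subspace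
is invariant. -/
theorem act23_tripleMap (hτ : 0 < τ.im) (hr : r ≠ 0) {a b : RSOSGroupoid n r} {γ : a ⟶ b}
    {v : Fin n × Fin n × Fin n → ℂ} (hv : v ∈ tripleSpan γ) :
    (dynR23 τ r z a.1).mulVec v ∈ tripleSpan γ ∧
      Hom.app (act23 (rsosR n r τ z)) γ (tripleMap γ v) =
        tripleMap γ ((dynR23 τ r z a.1).mulVec v) := by
  induction hv using Submodule.span_induction with
  | mem v hv =>
    obtain ⟨i, j, k, h, rfl⟩ := hv
    rw [tripleMap_tripleVec]
    rcases eq_or_ne j k with rfl | hne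
    · rw [dynR23_mulVec_self, tripleMap_tripleVec]
      exact ⟨tripleVec_mem h, act23_rsosTriple_self z h⟩
    · rw [dynR23_mulVec_of_ne _ _ _ _ hne]
      refine ⟨Submodule.add_mem _ (smul_tripleVec_mem (Or.inl h)) (smul_tripleVec_mem ?_), ?_⟩
      · by_cases hk : a.1 + Orbit.proj n (eps i) + Orbit.proj n (eps k) ∈ regularDominant n r
        · refine Or.inl ⟨h.fst_mem, ?_, ?_⟩
          · rw [map_add, ← add_assoc]
            exact hk
          · rw [add_right_comm]
            exact h.weight_eq
        · refine Or.inr (swapWeight_eq_zero_of_notMem hτ hr h.fst_mem hne ?_ hk z)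
          rw [add_assoc, ← map_add, ← add_assoc]
          exact target_mem γ h.weight_eq
      · rw [act23_rsosTriple_of_ne z hne h, (tripleMap γ).map_add, (tripleMap γ).map_smul,
          (tripleMap γ).map_smul, tripleMap_tripleVec, tripleMap_tripleVec]
  | zero =>
    rw [Matrix.mulVec_zero, map_zero, map_zero]
    exact ⟨Submodule.zero_mem _, rfl⟩
  | add v w _ _ hv hw =>
    rw [Matrix.mulVec_add, map_add, map_add, map_add, hv.2, hw.2]
    exact ⟨Submodule.add_mem _ hv.1 hw.1, rfl⟩
  | smul c v _ hv =>
    rw [Matrix.mulVec_smul, map_smul, map_smul, map_smul, hv.2]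
    exact ⟨Submodule.smul_mem _ _ hv.1, rfl⟩

theorem rsosR_yang_baxter (hτ : 0 < τ.im) (hr : r ≠ 0) {u v : ℂ}
    (hu : ellBracket τ r (1 - u) ≠ 0) (hv : ellBracket τ r (1 - v) ≠ 0)
    (huv : ellBracket τ r (1 - (u + v)) ≠ 0) :
    act23 (rsosR n r τ v) ≫ act12 (rsosR n r τ (u + v)) ≫ act23 (rsosR n r τ u) =
      act12 (rsosR n r τ u) ≫ act23 (rsosR n r τ (u + v)) ≫ act12 (rsosR n r τ v) := by
  refine hom_ext_app fun {a b} γ => linearMap_ext_rsosTriple fun i j k h => ?_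
  have hb : a.1 + Orbit.proj n (eps i + eps j + eps k) ∈ regularDominant n r :=
    target_mem γ h.weight_eq
  have hd := dybe_tripleVec hτ hr a.2 i j k hb hu hv huv
  simp only [← Matrix.mulVec_mulVec] at hd
  have l1 := act23_tripleMap (τ := τ) v hτ hr (tripleVec_mem h)
  have l2 := act12_tripleMap (τ := τ) (u + v) hτ hr l1.1
  have l3 := act23_tripleMap (τ := τ) u hτ hr l2.1
  have r1 := act12_tripleMap (τ := τ) u hτ hr (tripleVec_mem h)
  have r2 := act23_tripleMap (τ := τ) (u + v) hτ hr r1.1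
  have r3 := act12_tripleMap (τ := τ) v hτ hr r2.1
  rw [comp_app_apply, comp_app_apply, comp_app_apply, comp_app_apply, ← tripleMap_tripleVec,
    l1.2, l2.2, l3.2, r1.2, r2.2, r3.2, hd]

end Triples

/-! ### Poles of the operator -/

section Poles

variable {n r : ℕ} {τ : ℂ}

/-- The sum of the coordinates on a component of the restricted vector representation. -/
def coordSum {a b : RSOSGroupoid n r} (f : a ⟶ b) : (rsosRep n r).carrier f →ₗ[ℂ] ℂ :=
  Fintype.linearCombination ℂ fun _ : {i : Fin n // eps i = Orbit.weight f.hom} => (1 : ℂ)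

theorem coordSum_unitVec {a b : RSOSGroupoid n r} (f : a ⟶ b) (i : Fin n)
    (h : eps i = Orbit.weight f.hom) : coordSum f (unitVec f i h) = 1 :=
  (Fintype.linearCombination_apply_single ℂ _ _ _).trans (one_smul ℂ 1)

/-- A linear form taking the value `1` on all paths with the ends of `γ`. -/
def pathSum {a b : RSOSGroupoid n r} (γ : a ⟶ b) :
    (tensor (rsosRep n r) (rsosRep n r)).carrier γ →ₗ[ℂ] ℂ :=
  tensorLift fun p => (LinearMap.mul ℂ ℂ).compl₁₂ (coordSum p.fst) (coordSum p.snd)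

theorem pathSum_rsosPath {a b : RSOSGroupoid n r} (γ : a ⟶ b) {i j : Fin n}
    (hi : a.1 + Orbit.proj n (eps i) ∈ regularDominant n r)
    (hij : eps i + eps j = Orbit.weight γ.hom) : pathSum γ (rsosPath γ i j) = 1 := by
  rw [← tensorMk_unitVec (rsosFactorization γ (eps i) (eps j) hi hij) i j rfl rfl, pathSum,
    tensorLift_tensorMk]
  refine (LinearMap.compl₁₂_apply _ _ _ _ _).trans ?_
  refine (congrArg₂ (· * ·) (coordSum_unitVec _ _ _) (coordSum_unitVec _ _ _)).trans ?_
  exact one_mul 1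

theorem ellBracket_one_ne_zero (hτ : 0 < τ.im) (hr : 1 < r) : ellBracket τ r 1 ≠ 0 := by
  intro h
  have := (ellBracket_intCast_eq_zero_iff hτ (by omega : r ≠ 0) 1).mp (by simpa using h)
  have := Int.le_of_dvd one_pos this
  omega

/-- At a zero of `[1 - z]` the weight `stayWeight` for `a_i - a_j = 1` has a pole. -/
theorem ellBracket_ne_zero_of_continuousAt_stayWeight (hτ : 0 < τ.im) (hr : 2 < r) {z : ℂ}
    (h : ContinuousAt (fun z => stayWeight (ellBracket τ r) z 1) z) :
    ellBracket τ r (1 - z) ≠ 0 := by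
  intro h0
  have hr0 : r ≠ 0 := by omega
  have hf := differentiable_ellBracket hτ r
  have h1 := ellBracket_one_ne_zero (r := r) hτ (by omega)
  have hg : Differentiable ℂ fun w => ellBracket τ r (1 - w) := by fun_prop
  have hN : Differentiable ℂ fun w => ellBracket τ r (1 + w) * ellBracket τ r 1 := by fun_prop
  have hne : ∀ᶠ w in nhdsWithin z {z}ᶜ, ellBracket τ r (1 - w) ≠ 0 := by
    refine (hg.analyticAt z).eventually_eq_zero_or_eventually_ne_zero.resolve_left fun hz => ?_
    have han : AnalyticOnNhd ℂ (fun w => ellBracket τ r (1 - w)) Set.univ :=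
      fun y _ => hg.analyticAt y
    have := congrFun (han.eq_of_eventuallyEq (fun y _ => analyticAt_const) hz) 0
    simp only [sub_zero] at this
    exact h1 this
  have hlim1 : Filter.Tendsto (fun w => stayWeight (ellBracket τ r) w 1 *
      (ellBracket τ r 1 * ellBracket τ r (1 - w))) (nhdsWithin z {z}ᶜ) (nhds 0) := by
    have := (h.mul (continuousAt_const.mul hg.continuous.continuousAt)).tendsto
      (f := fun w => stayWeight (ellBracket τ r) w 1 *
        (ellBracket τ r 1 * ellBracket τ r (1 - w)))
    simp only [h0, mul_zero] at this
    exact this.mono_left nhdsWithin_le_nhds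
  have hlim2 : Filter.Tendsto (fun w => stayWeight (ellBracket τ r) w 1 *
      (ellBracket τ r 1 * ellBracket τ r (1 - w))) (nhdsWithin z {z}ᶜ)
      (nhds (ellBracket τ r (1 + z) * ellBracket τ r 1)) := by
    refine (hN.continuous.continuousAt.tendsto.mono_left nhdsWithin_le_nhds).congr' ?_
    filter_upwards [hne] with w hw
    rw [stayWeight, div_mul_cancel₀ _ (mul_ne_zero h1 hw)]
  have hz := tendsto_nhds_unique hlim2 hlim1
  have hz' := (mul_eq_zero.mp hz).resolve_right h1
  -- now `1 - z` and `1 + z` lie in the lattice, hence so does `2`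
  obtain ⟨p, q, hpq⟩ := (ellBracket_eq_zero_iff hτ hr0 _).mp h0
  obtain ⟨p', q', hpq'⟩ := (ellBracket_eq_zero_iff hτ hr0 _).mp hz'
  have h2 : ellBracket τ r ((2 : ℤ) : ℂ) = 0 := by
    refine (ellBracket_eq_zero_iff hτ hr0 _).mpr ⟨p + p', q + q', ?_⟩
    push_cast
    linear_combination hpq + hpq'
  have := Int.le_of_dvd two_pos ((ellBracket_intCast_eq_zero_iff hτ hr0 2).mp h2)
  omega

/-- The point `ρ = (n - 1, …, 1, 0)` of the orbit, represented by `(0, -1, …, 1 - n)`. -/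
def rhoPoint (n : ℕ) : Orbit n := Orbit.proj n fun i => -(i : ℤ)

theorem diff_rhoPoint_add (i j : Fin n) (μ : Fin n → ℤ) :
    Orbit.diff i j (rhoPoint n + Orbit.proj n μ) = j - i + (μ i - μ j) := by
  rw [Orbit.diff_add_proj, rhoPoint, Orbit.diff_proj]
  ring

/-- For `n ≥ 2` the restricted operator is singular at the zeros of `[1 - z]`: at `ρ` it multiplies
`e_1 ⊗ e_2` by a function with a pole there, the path that starts with `ε_2` being forbidden. -/
theorem ellBracket_ne_zero_of_regularAt (hτ : 0 < τ.im) (hn : 2 ≤ n) (hr : n < r) {z : ℂ}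
    (h : RegularAt (rsosR n r τ) z) : ellBracket τ r (1 - z) ≠ 0 := by
  let i₀ : Fin n := ⟨0, by omega⟩
  let i₁ : Fin n := ⟨1, by omega⟩
  have hne : i₀ ≠ i₁ := by simp [i₀, i₁, Fin.ext_iff]
  have hmem : ∀ μ : Fin n → ℤ, (∀ p q : Fin n, p < q →
      0 < (q : ℤ) - p + (μ p - μ q) ∧ (q : ℤ) - p + (μ p - μ q) < r) →
      rhoPoint n + Orbit.proj n μ ∈ regularDominant n r := by
    intro μ hμ p q hpq
    rw [diff_rhoPoint_add]
    exact hμ p q hpq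
  have ha : rhoPoint n ∈ regularDominant n r := by
    have := hmem 0 fun p q hpq => by
      have := q.2
      have : (p : ℕ) < q := hpq
      simp only [Pi.zero_apply]
      omega
    rwa [map_zero, add_zero] at this
  have hi : rhoPoint n + Orbit.proj n (eps i₀) ∈ regularDominant n r := by
    refine hmem _ fun p q hpq => ?_
    have := q.2
    have : (p : ℕ) < q := hpq
    simp only [eps, Pi.single_apply, i₀, Fin.ext_iff]
    split_ifs <;> omega
  have hb : rhoPoint n + Orbit.proj n (eps i₀ + eps i₁) ∈ regularDominant n r := by
    refine hmem _ fun p q hpq => ?_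
    have := q.2
    have : (p : ℕ) < q := hpq
    simp only [eps, Pi.add_apply, Pi.single_apply, i₀, i₁, Fin.ext_iff]
    split_ifs <;> omega
  have hj : rhoPoint n + Orbit.proj n (eps i₁) ∉ regularDominant n r := by
    intro hj
    have := (hj i₀ i₁ (by simp [i₀, i₁])).1
    rw [diff_rhoPoint_add] at this
    simp [eps, i₀, i₁] at this
  have hd : Orbit.diff i₀ i₁ (rhoPoint n) = 1 := by
    have := diff_rhoPoint_add i₀ i₁ 0
    simpa [i₀, i₁] using this
  let a : RSOSGroupoid n r := ⟨rhoPoint n, ha⟩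
  let b : RSOSGroupoid n r := ⟨rhoPoint n + Orbit.proj n (eps i₀ + eps i₁), hb⟩
  let γ : a ⟶ b := rsosArrow a b (eps i₀ + eps i₁) rfl
  have hγ : eps i₀ + eps i₁ = Orbit.weight γ.hom := rfl
  apply ellBracket_ne_zero_of_continuousAt_stayWeight hτ (by omega)
  have hcont := (h γ (rsosPath γ i₀ i₁) (pathSum γ)).continuousAt
  have e : (fun z => pathSum γ (Hom.app (rsosR n r τ z) γ (rsosPath γ i₀ i₁))) =
      fun z => stayWeight (ellBracket τ r) z 1 := by
    funext z
    rw [rsosR_rsosPath_of_ne τ z γ hne hi hγ, rsosPath_of_notMem γ i₀ hj, smul_zero, add_zero,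
      map_smul, pathSum_rsosPath γ hi hγ, smul_eq_mul, mul_one]
    change stayWeight (ellBracket τ r) z (Orbit.diff i₀ i₁ (rhoPoint n) : ℤ) = _
    rw [hd, Int.cast_one]
  rwa [e] at hcont

theorem rsosR_eq_of_subsingleton [Subsingleton (Fin n)] (z w : ℂ) :
    rsosR n r τ z = rsosR n r τ w := by
  refine hom_ext_app fun {a b} γ => linearMap_ext_rsosPath fun i j hi hij => ?_
  obtain rfl : i = j := Subsingleton.elim i j
  rw [rsosR_rsosPath_self τ z γ hi hij, rsosR_rsosPath_self τ w γ hi hij]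

theorem isYangBaxterOperator_rsosR (hτ : 0 < τ.im) (hn : 1 ≤ n) (hr : n < r) :
    IsYangBaxterOperator (rsosRep n r) (rsosR n r τ) := by
  have hr0 : r ≠ 0 := by omega
  refine ⟨meromorphicFamily_rsosR hτ hr0, fun z w hz hw hzw => ?_, fun z hz hz' => ?_⟩
  · rcases hn.eq_or_lt with rfl | hn
    · have h1 : ellBracket τ r (1 - 0) ≠ 0 := by
        rw [sub_zero]
        exact ellBracket_one_ne_zero hτ hr
      have := rsosR_yang_baxter (n := 1) hτ hr0 h1 h1 (by rwa [add_zero])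
      rwa [rsosR_eq_of_subsingleton z (0 + 0), rsosR_eq_of_subsingleton w 0,
        rsosR_eq_of_subsingleton (z - w) 0]
    · have := rsosR_yang_baxter (n := n) (u := z - w) (v := w) hτ hr0
        (ellBracket_ne_zero_of_regularAt hτ hn hr hzw)
        (ellBracket_ne_zero_of_regularAt hτ hn hr hw)
        (by
          rw [sub_add_cancel]
          exact ellBracket_ne_zero_of_regularAt hτ hn hr hz)
      rwa [sub_add_cancel] at this
  · rcases hn.eq_or_lt with rfl | hn
    · have h1 : ellBracket τ r 1 ≠ 0 := ellBracket_one_ne_zero hτ hr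
      have := rsosR_inversion (n := 1) (z := 0) hτ hr0 (by rwa [sub_zero])
        (by rwa [neg_zero, sub_zero])
      rwa [rsosR_eq_of_subsingleton z 0, rsosR_eq_of_subsingleton (-z) (-0)]
    · exact rsosR_inversion hτ hr0 (ellBracket_ne_zero_of_regularAt hτ hn hr hz)
        (ellBracket_ne_zero_of_regularAt hτ hn hr hz')

end Poles

end

theorem mainTheorem5 (n r : ℕ) (hn : 1 ≤ n) (hr : n < r) (τ : ℂ) (hτ : 0 < τ.im) :
    -- the groupoid has finitely many objects, and no pole in the dynamical variable meets them
    Finite (RSOSGroupoid n r) ∧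
    (∀ a ∈ regularDominant n r, ∀ i j : Fin n, i ≠ j →
      ellBracket τ r (Orbit.diff i j a : ℂ) ≠ 0) ∧
    -- the dynamical Yang–Baxter equation on the restricted space
    (∀ a ∈ regularDominant n r, ∀ z w : ℂ, 1 - z ∉ ellLattice τ r → 1 - w ∉ ellLattice τ r →
      1 - (z - w) ∉ ellLattice τ r →
      ∀ v : Fin n × Fin n × Fin n → ℂ, (∀ x, x ∉ rsosPaths r a → v x = 0) →
        (dynR23 τ r (z - w) a * dynR12 τ r z a * dynR23 τ r w a).mulVec v =
          (dynR12 τ r w a * dynR23 τ r z a * dynR12 τ r (z - w) a).mulVec v) ∧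
    -- the restriction exists and is a Yang–Baxter operator in the category of graded spaces
    (∃ R : ℂ → (GradedVect.tensor (rsosRep n r) (rsosRep n r) ⟶
        GradedVect.tensor (rsosRep n r) (rsosRep n r)),
      (∀ z : ℂ, GradedVect.IsRestriction (ellROp n r τ z) (R z)) ∧
      (∀ z : ℂ, 1 - z ∉ ellLattice τ r → GradedVect.RegularAt R z) ∧
      GradedVect.IsYangBaxterOperator (rsosRep n r) R) := by
  have hr0 : r ≠ 0 := by omega
  have hL : ∀ {z : ℂ}, z ∉ ellLattice τ r → ellBracket τ r z ≠ 0 :=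
    fun hz h => hz ((ellBracket_eq_zero_iff hτ hr0 _).mp h)
  refine ⟨finite_rsosGroupoid n hr0, fun a ha i j hij => ellBracket_diff_ne_zero hτ hr0 ha hij,
    fun a ha z w hz hw hzw v hv => ?_, rsosR n r τ, isRestriction_rsosR hτ hr0,
    fun z hz => regularAt_rsosR hτ hr0 (hL hz), isYangBaxterOperator_rsosR hτ hn hr⟩
  rw [sum_smul_tripleVec v, Matrix.mulVec_sum, Matrix.mulVec_sum]
  refine Finset.sum_congr rfl fun x _ => ?_
  rw [Matrix.mulVec_smul, Matrix.mulVec_smul]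
  by_cases hx : x ∈ rsosPaths r a
  · have := dybe_tripleVec (u := z - w) (v := w) hτ hr0 ha x.1 x.2.1 x.2.2 hx.2.2 (hL hzw) (hL hw)
      (by
        rw [sub_add_cancel]
        exact hL hz)
    rw [sub_add_cancel] at this
    rw [this]
  · rw [hv x hx, zero_smul, zero_smul]
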